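/- Let $T^2=\mathbb R^2/\mathbb Z^2$ carry the flat Riemannian metric and the area form $dx\wedge dy$ (total area $1$). Let $\mathrm{Diff}_0(T^2,dx\wedge dy)$ be the group of diffeomorphisms of $T^2$ that are smoothly isotopic to the identity through diffeomorphisms preserving $dx\wedge dy$, and let $\mathrm{Ham}(T^2,dx\wedge dy)$ be its subgroup of time-one maps of Hamiltonian isotopies, i.e. of smooth isotopies $\{\phi_t\}_{t\in[0,1]}$ with $\phi_0=\mathrm{id}$ whose generating vector field $X_t=\frac{d}{ds}\big|_{s=t}\phi_s\circ\phi_t^{-1}$ satisfies $(dx\wedge dy)(X_t,\cdot)=dH_t$ for some smooth $H:[0,1]\times T^2\to\mathbb R$. For $\mathcal G$ either of the two groups, the $L^1$-metric on $\mathcal G$ is $$d_{\mathcal G}(\phi,\psi)=\inf\int_0^1\int_{T^2}|X_t|\,dx\,dy\,dt ,$$ the infimum being over the smooth isotopies $\{\phi_t\}_{t\in[0,1]}$ in $\mathcal G$ with $\phi_0=\mathrm{id}$ and $\phi_1=\psi\phi^{-1}$, where $X_t$ is the vector field generating $\{\phi_t\}$. Then both $L^1$-metrics take finite values, and the inclusion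 $$\iota:(\mathrm{Ham}(T^2,dx\wedge dy),d_{\mathrm{Ham}})\hookrightarrow(\mathrm{Diff}_0(T^2,dx\wedge dy),d_{\mathrm{Diff}_0})$$ is a quasi-isometry: there are $A,B\ge 0$ such that $d_{\mathrm{Diff}_0}(\iota h,\iota k)\le A\,d_{\mathrm{Ham}}(h,k)+B$ and $d_{\mathrm{Ham}}(h,k)\le A\,d_{\mathrm{Diff}_0}(\iota h,\iota k)+B$ for all $h,k\in\mathrm{Ham}(T^2,dx\wedge dy)$, and the image of $\iota$ is coarsely dense (there is $C\ge 0$ such that every element of $\mathrm{Diff}_0(T^2,dx\wedge dy)$ is at distance at most $C$ from the image). Moreover $\iota$ is bi-Lipschitz: there is $0<c<1$ with $$c\cdot d_{\mathrm{Ham}}(h,k)\le d_{\mathrm{Diff}_0}(\iota h,\iota k)\le d_{\mathrm{Ham}}(h,k)\qquad\text{for all }h,k\in\mathrm{Ham}(T^2,dx\wedge dy).$$ -/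

import Mathlib

open Set MeasureTheory
open scoped ContDiff ENNReal NNReal

noncomputable section

namespace TorusL1

/-- The torus `T² = ℝ² / ℤ²`, carrying Mathlib's Haar measure, which is Lebesgue measure `dx dy`
of total mass `1`. -/
abbrev Torus : Type := UnitAddTorus (Fin 2)

/-- The Euclidean plane: the universal cover of the torus and, by translation, its tangent space
at every point, with the norm of the flat Riemannian metric. -/
abbrev Plane : Type := EuclideanSpace ℝ (Fin 2)

/-- The covering projection `ℝ² → ℝ² / ℤ²`. -/
def proj (u : Plane) : Torus := fun i => (u i : UnitAddCircle)

/-- The representative of a point of the torus in the square `[0, 1)²`. -/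
def rep (x : Torus) : Plane :=
  WithLp.toLp 2 fun i => (AddCircle.equivIco (1 : ℝ) 0 (x i) : ℝ)

theorem proj_rep (x : Torus) : proj (rep x) = x := by
  funext i
  exact (AddCircle.equivIco (1 : ℝ) 0).symm_apply_apply (x i)

/-- The area form `dx ∧ dy`. -/
def areaForm (v w : Plane) : ℝ := v 0 * w 1 - v 1 * w 0

/-- `F` is a lift of the self-map `f` of the torus to the plane. -/
def IsLift (F : Plane → Plane) (f : Torus → Torus) : Prop :=
  ∀ u, proj (F u) = f (proj u)

/-- A self-map of the torus is smooth when it has a smooth lift to the plane. (The plane being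
simply connected, every continuous self-map of the torus lifts.) -/
def IsSmooth (f : Torus → Torus) : Prop :=
  ∃ F : Plane → Plane, ContDiff ℝ ∞ F ∧ IsLift F f

/-- `f` is smooth and pulls `dx ∧ dy` back to itself: in the trivialisation of the tangent bundle
by translations the derivative of `f` at `proj u` is the derivative of a lift of `f` at `u`. -/
def PreservesArea (f : Torus → Torus) : Prop :=
  ∃ F : Plane → Plane, ContDiff ℝ ∞ F ∧ IsLift F f ∧
    ∀ u v w, areaForm (fderiv ℝ F u v) (fderiv ℝ F u w) = areaForm v w

/-- `Diff(T², dx ∧ dy)`: the diffeomorphisms of the torus that preserve `dx ∧ dy`. -/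
def areaDiff : Set (Equiv.Perm Torus) :=
  {φ | PreservesArea φ ∧ IsSmooth φ.symm}

/-- A smooth isotopy `(φ_t)`, `t ∈ [0, 1]`, of area-preserving diffeomorphisms of the torus with
`φ_0 = id`, together with a lift to the plane of the smooth map `(t, x) ↦ φ_t x` (the lift is
unique up to adding a vector in `ℤ²`). Nothing is asked for `t` outside `[0, 1]`. -/
structure Isotopy where
  /-- the diffeomorphisms `φ_t` -/
  map : ℝ → Equiv.Perm Torus
  /-- the lift -/
  lift : ℝ → Plane → Plane
  map_mem : ∀ t ∈ Icc (0 : ℝ) 1, map t ∈ areaDiff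
  map_zero : map 0 = 1
  smooth : ContDiffOn ℝ ∞ (fun p : ℝ × Plane => lift p.1 p.2) (Icc 0 1 ×ˢ univ)
  isLift : ∀ t ∈ Icc (0 : ℝ) 1, IsLift (lift t) (map t)

namespace Isotopy

/-- The time-dependent vector field `X_t = (d/ds)|_{s = t} φ_s ∘ φ_t⁻¹` generating the isotopy.
The time derivative of the lift at a point of the plane depends only on the projection of the point
to the torus. -/
def velocity (g : Isotopy) (t : ℝ) (x : Torus) : Plane :=
  derivWithin (fun s => g.lift s (rep ((g.map t)⁻¹ x))) (Icc 0 1) t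

/-- The `L¹`-length `∫₀¹ ∫_{T²} |X_t| dx dy dt` (the total area is `1`). -/
def length (g : Isotopy) : ℝ≥0∞ :=
  ∫⁻ t in Icc (0 : ℝ) 1, ∫⁻ x : Torus, ‖g.velocity t x‖ₑ

/-- The isotopy is Hamiltonian: there is a smooth `H : [0, 1] × T² → ℝ` with
`(dx ∧ dy)(X_t, ·) = dH_t` for every `t`. -/
def IsHamiltonian (g : Isotopy) : Prop :=
  ∃ H : ℝ → Torus → ℝ,
    ContDiffOn ℝ ∞ (fun p : ℝ × Plane => H p.1 (proj p.2)) (Icc 0 1 ×ˢ univ) ∧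
    ∀ t ∈ Icc (0 : ℝ) 1, ∀ u v : Plane,
      areaForm (g.velocity t (proj u)) v = fderiv ℝ (fun w => H t (proj w)) u v

end Isotopy

/-- `Diff₀(T², dx ∧ dy)`: the area-preserving diffeomorphisms isotopic to the identity through
area-preserving diffeomorphisms. -/
def diff0 : Set (Equiv.Perm Torus) :=
  {φ | ∃ g : Isotopy, g.map 1 = φ}

/-- `Ham(T², dx ∧ dy)`: the time-one maps of Hamiltonian isotopies. -/
def ham : Set (Equiv.Perm Torus) :=
  {φ | ∃ g : Isotopy, g.IsHamiltonian ∧ g.map 1 = φ}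

theorem ham_subset_diff0 : ham ⊆ diff0 := fun _ ⟨g, _, h⟩ => ⟨g, h⟩

/-- The `L¹`-metric of a group `S` of area-preserving diffeomorphisms: `d(φ, ψ)` is the infimum of
the `L¹`-lengths of the smooth isotopies within `S` from the identity to `ψ ∘ φ⁻¹`. -/
def l1Dist (S : Set (Equiv.Perm Torus)) (φ ψ : S) : ℝ≥0∞ :=
  ⨅ (g : Isotopy) (_ : ∀ t ∈ Icc (0 : ℝ) 1, g.map t ∈ S)
    (_ : g.map 1 = (ψ : Equiv.Perm Torus) * (φ : Equiv.Perm Torus)⁻¹), g.length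

/-- The inclusion `Ham(T², dx ∧ dy) → Diff₀(T², dx ∧ dy)`. -/
def hamIncl : ham → diff0 := Set.inclusion ham_subset_diff0

/-- The image of `f` is coarsely dense for the distance `dY`. -/
def IsCoarselyDense {X Y : Type*} (dY : Y → Y → ℝ≥0∞) (f : X → Y) : Prop :=
  ∃ C : ℝ≥0, ∀ y, ∃ x, dY (f x) y ≤ C

/-- `f` is a quasi-isometry from `(X, dX)` to `(Y, dY)`. -/
def IsQuasiIsometry {X Y : Type*} (dX : X → X → ℝ≥0∞) (dY : Y → Y → ℝ≥0∞) (f : X → Y) : Prop :=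
  (∃ A B : ℝ≥0, ∀ x x',
    dY (f x) (f x') ≤ A * dX x x' + B ∧ dX x x' ≤ A * dY (f x) (f x') + B) ∧
  IsCoarselyDense dY f

end TorusL1

end

noncomputable section

namespace TorusL1

/-! ### The lattice, the unit cell and the covering projection -/

/-! The point is that an isotopy can be made Hamiltonian by composing it with translations, at the
cost of at most doubling its length. In the flat trivialisation the velocity $X_t$ has a mean vector
over the torus. Area preservation makes the one-form $\omega(X_t,\cdot)$ closed, and its periods are
the pairings of that mean with lattice vectors, so the form is exact exactly when the mean vanishes
(`IsComplete.isHamiltonian`, `IsHamiltonian.setIntegral_timeDeriv`).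

The flux is the time integral of the mean, that is, the average displacement of a lift. Composing
$\phi_t$ with the translation by minus the mean displacement accumulated up to time $t$ gives
mean-zero velocity. The length at most doubles because the norm of the mean is at most the
$L^1$-norm. The endpoint is unchanged when the flux lies in $\mathbb Z^2$
(`exists_isHamiltonian_of_flux`).

An isotopy ending in Ham does have lattice flux: Hamiltonian isotopies have flux zero, and two
isotopies with the same endpoint have fluxes differing by a lattice vector. Hence
$d_{\mathrm{Ham}}\le 2\,d_{\mathrm{Diff}_0}$; the other inequality holds because Ham lies in Diff₀.
For coarse density, an element of Diff₀ differs from a Hamiltonian one by a translation of the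
torus, and translations have bounded length. -/

/-- The inclusion `ℤ² → ℝ²`. -/
def latticePt : (Fin 2 → ℤ) →+ Plane where
  toFun m := WithLp.toLp 2 fun i => (m i : ℝ)
  map_zero' := by ext i; simp
  map_add' m n := by ext i; simp

@[simp] theorem latticePt_apply (m : Fin 2 → ℤ) (i : Fin 2) : latticePt m i = m i := rfl

theorem latticePt_injective : Function.Injective latticePt := fun m n h => by
  funext i
  have := congrArg (fun v : Plane => v i) h
  simpa using this

/-- The half-open unit square. -/
def cell : Set Plane := {u | ∀ i, u i ∈ Ico (0 : ℝ) 1}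

theorem proj_add (u v : Plane) : proj (u + v) = proj u + proj v := by
  funext i; simp [proj]

theorem proj_sub (u v : Plane) : proj (u - v) = proj u - proj v := by
  funext i; simp [proj]

theorem proj_neg (u : Plane) : proj (-u) = -proj u := by
  funext i; simp [proj]

theorem proj_zero : proj 0 = 0 := by
  funext i; simp [proj]

theorem proj_eq_zero_iff {u : Plane} : proj u = 0 ↔ ∃ m, u = latticePt m := by
  constructor
  · intro h
    have h' : ∀ i, ∃ n : ℤ, (n : ℝ) = u i := fun i => by
      have hi := congrFun h i
      obtain ⟨n, hn⟩ := (AddCircle.coe_eq_zero_iff (1 : ℝ)).1 hi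
      exact ⟨n, by simpa using hn⟩
    choose m hm using h'
    exact ⟨m, by ext i; simp [hm]⟩
  · rintro ⟨m, rfl⟩
    funext i
    exact (AddCircle.coe_eq_zero_iff (1 : ℝ)).2 ⟨m i, by simp⟩

@[simp] theorem proj_latticePt (m : Fin 2 → ℤ) : proj (latticePt m) = 0 :=
  proj_eq_zero_iff.2 ⟨m, rfl⟩

@[simp] theorem proj_add_latticePt (u : Plane) (m : Fin 2 → ℤ) :
    proj (u + latticePt m) = proj u := by
  rw [proj_add, proj_latticePt, add_zero]

theorem proj_eq_proj_iff {u v : Plane} : proj u = proj v ↔ ∃ m, u = v + latticePt m := by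
  rw [← sub_eq_zero, ← proj_sub, proj_eq_zero_iff]
  simp only [sub_eq_iff_eq_add']

theorem rep_mem_cell (x : Torus) : rep x ∈ cell := fun i => by
  simpa [rep] using (AddCircle.equivIco (1 : ℝ) 0 (x i)).2

theorem eq_of_mem_cell_of_proj_eq {u v : Plane} (hu : u ∈ cell) (hv : v ∈ cell)
    (h : proj u = proj v) : u = v := by
  ext i
  have h' : ((u i : ℝ) : UnitAddCircle) = (v i : ℝ) := congrFun h i
  refine (AddCircle.coe_eq_coe_iff_of_mem_Ico (p := (1 : ℝ)) (a := 0) ?_ ?_).1 h'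
  · simpa using hu i
  · simpa using hv i

theorem rep_proj {u : Plane} (hu : u ∈ cell) : rep (proj u) = u :=
  eq_of_mem_cell_of_proj_eq (rep_mem_cell _) hu (proj_rep _)

theorem exists_eq_rep_add (u : Plane) : ∃ m, u = rep (proj u) + latticePt m :=
  proj_eq_proj_iff.1 (proj_rep _).symm

theorem continuous_proj : Continuous proj := by
  unfold proj
  refine continuous_pi fun i => ?_
  exact (AddCircle.continuous_mk' (1 : ℝ)).comp (by fun_prop)

theorem measurable_rep : Measurable rep := by
  refine (WithLp.measurable_toLp 2 _).comp (measurable_pi_lambda _ fun i => ?_)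
  exact measurable_subtype_coe.comp
    ((AddCircle.measurableEquivIco (1 : ℝ) 0).measurable.comp (measurable_pi_apply i))

theorem cell_eq_preimage :
    cell = (WithLp.ofLp : Plane → Fin 2 → ℝ) ⁻¹' (univ.pi fun _ => Ico (0 : ℝ) 1) := by
  ext u; simp [cell]

theorem measurableSet_cell : MeasurableSet cell := by
  rw [cell_eq_preimage]
  exact (WithLp.measurable_ofLp 2 _) (MeasurableSet.univ_pi fun _ => measurableSet_Ico)

theorem measurePreserving_proj : MeasurePreserving proj (volume.restrict cell) volume := by
  have h1 : MeasurePreserving (WithLp.ofLp : Plane → Fin 2 → ℝ) (volume.restrict cell)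
      (Measure.pi fun _ => volume.restrict (Ico (0 : ℝ) 1)) := by
    rw [cell_eq_preimage, ← Measure.restrict_pi_pi]
    exact (PiLp.volume_preserving_ofLp (Fin 2)).restrict_preimage
      (MeasurableSet.univ_pi fun _ => measurableSet_Ico)
  have h2 : MeasurePreserving ((↑) : ℝ → UnitAddCircle) (volume.restrict (Ico (0 : ℝ) 1))
      volume := by
    have := UnitAddCircle.measurePreserving_mk 0
    rwa [zero_add, ← restrict_Ico_eq_restrict_Ioc] at this
  exact (measurePreserving_pi _ _ fun _ : Fin 2 => h2).comp h1

theorem measurePreserving_rep : MeasurePreserving rep volume (volume.restrict cell) := by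
  refine ⟨measurable_rep, ?_⟩
  rw [← measurePreserving_proj.map_eq, Measure.map_map measurable_rep measurePreserving_proj.1]
  have : rep ∘ proj =ᵐ[volume.restrict cell] id :=
    (ae_restrict_mem measurableSet_cell).mono fun u hu => rep_proj hu
  rw [Measure.map_congr this, Measure.map_id]

instance : IsProbabilityMeasure (volume.restrict cell : Measure Plane) := by
  refine ⟨?_⟩
  rw [Measure.restrict_apply_univ, cell_eq_preimage,
    (PiLp.volume_preserving_ofLp (Fin 2)).measure_preimage
      (MeasurableSet.univ_pi fun _ => measurableSet_Ico).nullMeasurableSet, Real.volume_pi_Ico]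
  simp

/-! ### Area-preserving linear maps -/

theorem areaForm_eq_zero_iff {v : Plane} : (∀ w, areaForm v w = 0) ↔ v = 0 := by
  constructor
  · intro h
    have h0 := h (EuclideanSpace.single 1 1)
    have h1 := h (EuclideanSpace.single 0 1)
    simp [areaForm] at h0 h1
    ext i
    fin_cases i <;> simp [h0, h1]
  · rintro rfl w
    simp [areaForm]

theorem det_eq_one_of_areaForm {A : Plane →L[ℝ] Plane}
    (hA : ∀ v w, areaForm (A v) (A w) = areaForm v w) : A.det = 1 := by
  have h := hA (EuclideanSpace.single 0 1) (EuclideanSpace.single 1 1)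
  rw [ContinuousLinearMap.det, ← LinearMap.det_toMatrix (EuclideanSpace.basisFun (Fin 2) ℝ).toBasis,
    Matrix.det_fin_two]
  simp [LinearMap.toMatrix_apply, areaForm] at h ⊢
  linarith

/-- An area-preserving endomorphism of the plane as a linear equivalence. -/
def equivOfAreaForm (A : Plane →L[ℝ] Plane)
    (hA : ∀ v w, areaForm (A v) (A w) = areaForm v w) : Plane ≃L[ℝ] Plane :=
  ContinuousLinearMap.toContinuousLinearEquivOfDetNeZero A
    (by rw [det_eq_one_of_areaForm hA]; exact one_ne_zero)

/-! ### Lifts -/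

/-- The lattice is discrete. This is the source of the uniqueness of lifts up to a lattice vector.
-/
theorem eq_of_continuous_of_mem_range_latticePt {X : Type*} [TopologicalSpace X]
    [PreconnectedSpace X] {c : X → Plane} (hc : Continuous c) (h : ∀ x, ∃ m, c x = latticePt m)
    (x y : X) : c x = c y := by
  choose m hm using h
  have hcont : ∀ i, Continuous fun x => m x i := fun i => by
    rw [Int.isClosedEmbedding_coe_real.isInducing.continuous_iff]
    have : (fun x => c x i) = (Int.cast : ℤ → ℝ) ∘ fun x => m x i := by
      funext x; simp [hm]
    rw [← this]
    fun_prop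
  ext i
  rw [hm, hm, latticePt_apply, latticePt_apply, PreconnectedSpace.constant ‹_› (hcont i)]

namespace IsLift

variable {F G : Plane → Plane} {f g : Torus → Torus}

theorem comp (hF : IsLift F f) (hG : IsLift G g) : IsLift (F ∘ G) (f ∘ g) := fun u => by
  simp only [Function.comp_apply, hF _, hG _]

theorem exists_eq_add (hF : IsLift F f) (hG : IsLift G f) (hFc : Continuous F)
    (hGc : Continuous G) : ∃ m, ∀ u, F u = G u + latticePt m := by
  have h : ∀ u, ∃ m, F u - G u = latticePt m := fun u =>
    proj_eq_zero_iff.1 (by rw [proj_sub, hF u, hG u, sub_self])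
  obtain ⟨m, hm⟩ := h 0
  refine ⟨m, fun u => ?_⟩
  have := eq_of_continuous_of_mem_range_latticePt (c := fun u => F u - G u) (hFc.sub hGc) h u 0
  rw [← hm, ← this, add_sub_cancel]

theorem measurable (hF : IsLift F f) (hFc : Continuous F) : Measurable f := by
  have : f = proj ∘ F ∘ rep := by
    funext x
    simp only [Function.comp_apply, hF _, proj_rep]
  rw [this]
  exact continuous_proj.measurable.comp (hFc.measurable.comp measurable_rep)

end IsLift

theorem IsSmooth.measurable {f : Torus → Torus} (hf : IsSmooth f) : Measurable f := by
  obtain ⟨F, hF, hl⟩ := hf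
  exact hl.measurable hF.continuous

theorem IsSmooth.comp {f g : Torus → Torus} (hf : IsSmooth f) (hg : IsSmooth g) :
    IsSmooth (f ∘ g) := by
  obtain ⟨F, hF, hl⟩ := hf
  obtain ⟨G, hG, hl'⟩ := hg
  exact ⟨F ∘ G, hF.comp hG, hl.comp hl'⟩

theorem PreservesArea.isSmooth {f : Torus → Torus} (hf : PreservesArea f) : IsSmooth f := by
  obtain ⟨F, hF, hl, -⟩ := hf
  exact ⟨F, hF, hl⟩

theorem PreservesArea.areaForm_fderiv {f : Torus → Torus} (hf : PreservesArea f)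
    {G : Plane → Plane} (hG : Continuous G) (hGl : IsLift G f) (u v w : Plane) :
    areaForm (fderiv ℝ G u v) (fderiv ℝ G u w) = areaForm v w := by
  obtain ⟨F, hF, hl, ha⟩ := hf
  obtain ⟨m, hm⟩ := hGl.exists_eq_add hl hG hF.continuous
  have : G = fun u => F u + latticePt m := funext hm
  rw [this, fderiv_add_const]
  exact ha u v w

theorem PreservesArea.comp {f g : Torus → Torus} (hf : PreservesArea f) (hg : PreservesArea g) :
    PreservesArea (f ∘ g) := by
  obtain ⟨F, hF, hl, ha⟩ := hf
  obtain ⟨G, hG, hl', ha'⟩ := hg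
  refine ⟨F ∘ G, hF.comp hG, hl.comp hl', fun u v w => ?_⟩
  rw [fderiv_comp _ (hF.differentiable (by simp) _) (hG.differentiable (by simp) _)]
  simp only [ContinuousLinearMap.comp_apply, ha, ha']

theorem isLift_add (v : Plane) : IsLift (· + v) (· + proj v) := fun u => proj_add u v

theorem isLift_id : IsLift id id := fun _ => rfl

theorem preservesArea_add (v : Plane) : PreservesArea (· + proj v) :=
  ⟨(· + v), by fun_prop, isLift_add v, fun u a b => by simp [fderiv_add_const]⟩

theorem addRight_mem_areaDiff (v : Plane) : Equiv.addRight (proj v) ∈ areaDiff := by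
  refine ⟨preservesArea_add v, ?_⟩
  have := (preservesArea_add (-v)).isSmooth
  rw [proj_neg] at this
  exact this

theorem one_mem_areaDiff : (1 : Equiv.Perm Torus) ∈ areaDiff := by
  have := addRight_mem_areaDiff 0
  rw [proj_zero] at this
  convert! this
  ext1 x
  simp

theorem mul_mem_areaDiff {φ ψ : Equiv.Perm Torus} (hφ : φ ∈ areaDiff) (hψ : ψ ∈ areaDiff) :
    φ * ψ ∈ areaDiff :=
  ⟨hφ.1.comp hψ.1, hψ.2.comp hφ.2⟩

/-- A lift of $\phi$ composed with a lift of $\phi^{-1}$ lifts the identity, hence is a lattice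
translation with derivative the identity. So the derivative of the inverse inverts an
area-preserving linear map. -/
theorem inv_mem_areaDiff {φ : Equiv.Perm Torus} (hφ : φ ∈ areaDiff) : φ⁻¹ ∈ areaDiff := by
  obtain ⟨hpa, A, hA, hAl⟩ := hφ
  refine ⟨?_, hpa.isSmooth⟩
  obtain ⟨F, hF, hl, ha⟩ := hpa
  refine ⟨A, hA, hAl, fun u v w => ?_⟩
  have hid : IsLift (F ∘ A) id := fun u => by
    simp [Function.comp_apply, hl _, hAl _]
  obtain ⟨m, hm⟩ := hid.exists_eq_add isLift_id (hF.continuous.comp hA.continuous) continuous_id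
  have hd : fderiv ℝ (F ∘ A) u = ContinuousLinearMap.id ℝ Plane := by
    rw [show F ∘ A = fun u => u + latticePt m from funext hm, fderiv_add_const, fderiv_fun_id]
  rw [fderiv_comp _ (hF.differentiable (by simp) _) (hA.differentiable (by simp) _)] at hd
  have h := fun v => DFunLike.congr_fun hd v
  simp only [ContinuousLinearMap.comp_apply, ContinuousLinearMap.id_apply] at h
  rw [← ha (A u), h, h]

/-! ### Area-preserving diffeomorphisms preserve the Haar measure -/

instance : Countable latticePt.range :=
  (Set.countable_range latticePt).to_subtype

theorem isAddFundamentalDomain_of_unique {s : Set Plane} (hs : MeasurableSet s)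
    (h : ∀ w : Plane, ∃! m : Fin 2 → ℤ, latticePt m + w ∈ s) :
    IsAddFundamentalDomain latticePt.range s volume := by
  refine IsAddFundamentalDomain.mk' hs.nullMeasurableSet fun w => ?_
  obtain ⟨m, hm, hu⟩ := h w
  refine ⟨⟨latticePt m, m, rfl⟩, hm, ?_⟩
  rintro ⟨_, n, rfl⟩ hn
  exact Subtype.ext (congrArg latticePt (hu n hn))

/-- Bijectivity of `φ` on the torus makes `F '' cell` a second fundamental domain for the lattice.
-/
theorem existsUnique_latticePt_add_mem_cell_image {φ : Equiv.Perm Torus} {F : Plane → Plane}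
    (hF : IsLift F φ) (w : Plane) : ∃! m : Fin 2 → ℤ, latticePt m + w ∈ F '' cell := by
  have hex : ∃ m, F (rep (φ.symm (proj w))) = w + latticePt m :=
    proj_eq_proj_iff.1 (by rw [hF, proj_rep, Equiv.apply_symm_apply])
  obtain ⟨m, hm⟩ := hex
  refine ⟨m, ⟨_, rep_mem_cell _, by rw [hm, add_comm]⟩, ?_⟩
  rintro n ⟨u, hu, hn⟩
  have h1 : φ (proj u) = proj w := by
    rw [← hF, hn, add_comm, proj_add_latticePt]
  have h2 : u = rep (φ.symm (proj w)) := by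
    rw [← h1, Equiv.symm_apply_apply, rep_proj hu]
  apply latticePt_injective
  rw [h2, hm, add_comm] at hn
  exact (add_right_cancel hn).symm

theorem injOn_cell_of_isLift {φ : Equiv.Perm Torus} {F : Plane → Plane}
    (hF : IsLift F φ) : InjOn F cell := fun u hu v hv h =>
  eq_of_mem_cell_of_proj_eq hu hv (φ.injective (by rw [← hF, ← hF, h]))

/-- Change of variables on `cell`: the lift is injective there with Jacobian one, and periodic
functions have the same integral over the fundamental domains `F '' cell` and `cell`. -/
theorem measurePreserving_of_mem_areaDiff {φ : Equiv.Perm Torus} (hφ : φ ∈ areaDiff) :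
    MeasurePreserving φ volume volume := by
  have hmeas := hφ.1.isSmooth.measurable
  obtain ⟨F, hF, hl, ha⟩ := hφ.1
  refine ⟨hmeas, ?_⟩
  ext s hs
  rw [Measure.map_apply hmeas hs]
  have hdiff : ∀ u ∈ cell, HasFDerivWithinAt F (fderiv ℝ F u) cell u := fun u _ =>
    (hF.differentiable (by simp) u).hasFDerivAt.hasFDerivWithinAt
  have hinj := injOn_cell_of_isLift hl
  have himage : MeasurableSet (F '' cell) :=
    measurableSet_cell.image_of_continuousOn_injOn hF.continuous.continuousOn hinj
  have hdom1 := isAddFundamentalDomain_of_unique himage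
    (existsUnique_latticePt_add_mem_cell_image hl)
  have hdom2 := isAddFundamentalDomain_of_unique measurableSet_cell (fun w => by
    simpa using existsUnique_latticePt_add_mem_cell_image
      (φ := 1) (F := id) isLift_id w)
  set f : Plane → ℝ≥0∞ := fun u => (s.indicator 1) (proj u) with hf
  have hfm : Measurable (s.indicator 1 : Torus → ℝ≥0∞) := measurable_one.indicator hs
  have hinv : ∀ (l : latticePt.range) (u : Plane), f (l +ᵥ u) = f u := by
    rintro ⟨_, m, rfl⟩ u
    simp only [hf]
    congr 1
    change proj (latticePt m + u) = _
    rw [add_comm, proj_add_latticePt]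
  have h1 := lintegral_image_eq_lintegral_abs_det_fderiv_mul volume measurableSet_cell hdiff hinj f
  rw [hdom1.setLIntegral_eq hdom2 f hinv] at h1
  simp only [det_eq_one_of_areaForm (ha _), abs_one, ENNReal.ofReal_one, one_mul] at h1
  have h2 : ∫⁻ u in cell, f u = volume s := by
    rw [measurePreserving_proj.lintegral_comp hfm, lintegral_indicator_one hs]
  have h3 : ∫⁻ u in cell, f (F u) = volume (φ ⁻¹' s) := by
    simp only [hf, hl _]
    rw [measurePreserving_proj.lintegral_comp (f := fun x => s.indicator 1 (φ x))
      (hfm.comp hmeas), ← lintegral_indicator_one (hmeas hs)]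
    rfl
  rw [← h2, ← h3, h1]

/-- An area-preserving diffeomorphism as a measurable equivalence. -/
def measurableEquivOfMem {φ : Equiv.Perm Torus} (hφ : φ ∈ areaDiff) : Torus ≃ᵐ Torus where
  toEquiv := φ
  measurable_toFun := hφ.1.isSmooth.measurable
  measurable_invFun := hφ.2.measurable

theorem lintegral_comp_of_mem_areaDiff {φ : Equiv.Perm Torus} (hφ : φ ∈ areaDiff)
    (f : Torus → ℝ≥0∞) : ∫⁻ x, f (φ x) = ∫⁻ x, f x :=
  (measurePreserving_of_mem_areaDiff hφ).lintegral_comp_emb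
    (measurableEquivOfMem hφ).measurableEmbedding f

variable {E : Type*} [NormedAddCommGroup E] [NormedSpace ℝ E]

theorem integral_comp_rep {q : Plane → E} (hq : Continuous q) :
    ∫ x : Torus, q (rep x) = ∫ u in cell, q u := by
  rw [← measurePreserving_rep.map_eq, integral_map measurable_rep.aemeasurable]
  exact hq.aestronglyMeasurable

/-- Periodic integrands descend to the torus, where `φ` preserves measure. This moves averages
between the points $\phi_t(x)$ and their starting points $x$. -/
theorem setIntegral_cell_comp_isLift {φ : Equiv.Perm Torus} (hφ : φ ∈ areaDiff)
    {F : Plane → Plane} (hF : Continuous F) (hl : IsLift F φ) {q : Plane → E} (hq : Continuous q)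
    (hper : ∀ u m, q (u + latticePt m) = q u) :
    ∫ u in cell, q (F u) = ∫ u in cell, q u := by
  have hrep : ∀ u, q (rep (proj u)) = q u := fun u => by
    obtain ⟨m, hm⟩ := exists_eq_rep_add u
    conv_rhs => rw [hm, hper]
  have h1 : ∫ x : Torus, q (F (rep x)) = ∫ u in cell, q (F u) :=
    integral_comp_rep (hq.comp hF)
  rw [← h1, ← integral_comp_rep hq,
    ← (measurePreserving_of_mem_areaDiff hφ).integral_comp
      (measurableEquivOfMem hφ).measurableEmbedding fun x => q (rep x)]
  refine integral_congr_ae (Filter.Eventually.of_forall fun x => ?_)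
  beta_reduce
  rw [← hrep, hl, proj_rep]

theorem setIntegral_cell_comp_add {q : Plane → E} (hq : Continuous q)
    (hper : ∀ u m, q (u + latticePt m) = q u) (v : Plane) :
    ∫ u in cell, q (u + v) = ∫ u in cell, q u :=
  setIntegral_cell_comp_isLift (addRight_mem_areaDiff v) (by fun_prop) (isLift_add v) hq hper

/-! ### Smoothness of integrals depending on a parameter -/

section Parametric

theorem integrable_of_continuous_of_isCompact {Y E : Type*} [NormedAddCommGroup Y] [MeasurableSpace Y]
    [BorelSpace Y] [SecondCountableTopology Y] [NormedAddCommGroup E]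
    {μ : Measure Y} [IsFiniteMeasure μ] {K : Set Y}
    (hK : IsCompact K) (hμ : ∀ᵐ y ∂μ, y ∈ K) {f : Y → E} (hf : Continuous f) :
    Integrable f μ := by
  obtain ⟨C, hC⟩ := hK.exists_bound_of_continuousOn hf.continuousOn
  exact Integrable.of_bound hf.aestronglyMeasurable C (hμ.mono fun y hy => hC y hy)

universe u

variable {P : Type u} [NormedAddCommGroup P] [NormedSpace ℝ P] [ProperSpace P]
  {Y : Type*} [NormedAddCommGroup Y] [NormedSpace ℝ Y] [MeasurableSpace Y] [BorelSpace Y]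
  [SecondCountableTopology Y] {μ : Measure Y} [IsFiniteMeasure μ] {K : Set Y}

theorem hasFDerivAt_integral_of_contDiff {E : Type*} [NormedAddCommGroup E] [NormedSpace ℝ E]
    (hK : IsCompact K) (hμ : ∀ᵐ y ∂μ, y ∈ K) {f : P → Y → E}
    (hf : ContDiff ℝ ∞ fun q : P × Y => f q.1 q.2) (p : P) :
    HasFDerivAt (fun p => ∫ y, f p y ∂μ)
      (∫ y, (fderiv ℝ (fun q : P × Y => f q.1 q.2) (p, y)).comp
        (ContinuousLinearMap.inl ℝ P Y) ∂μ) p := by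
  have hcont : Continuous fun q : P × Y => (fderiv ℝ (fun q : P × Y => f q.1 q.2) q).comp
      (ContinuousLinearMap.inl ℝ P Y) :=
    (hf.continuous_fderiv (by simp)).clm_comp continuous_const
  obtain ⟨C, hC⟩ := ((isCompact_closedBall p 1).prod hK).exists_bound_of_continuousOn
    hcont.continuousOn
  refine hasFDerivAt_integral_of_dominated_of_fderiv_le (bound := fun _ => C)
    (F' := fun p y => (fderiv ℝ (fun q : P × Y => f q.1 q.2) (p, y)).comp
        (ContinuousLinearMap.inl ℝ P Y))
    (Metric.closedBall_mem_nhds p one_pos) (Filter.Eventually.of_forall fun q => ?_) ?_ ?_ ?_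
    (integrable_const C) (Filter.Eventually.of_forall fun y q _ => ?_)
  · exact (hf.continuous.comp (by fun_prop : Continuous fun y => (q, y))).aestronglyMeasurable
  · exact integrable_of_continuous_of_isCompact hK hμ
      (hf.continuous.comp (by fun_prop : Continuous fun y => (p, y)))
  · exact (hcont.comp (by fun_prop : Continuous fun y => (p, y))).aestronglyMeasurable
  · exact hμ.mono fun y hy q hq => hC (q, y) ⟨hq, hy⟩
  · have h : HasFDerivAt (fun p : P => (p, y)) (ContinuousLinearMap.inl ℝ P Y) q :=
      hasFDerivAt_prodMk_left q y
    exact HasFDerivAt.comp q (hf.differentiable (by simp) (q, y)).hasFDerivAt h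

/-- Induction on the order of differentiability, with the derivative again an integral of the same
kind. The target becomes `P →L[ℝ] E`, which is why `E` shares the universe of `P`. -/
theorem contDiff_integral_of_contDiff {E : Type u} [NormedAddCommGroup E] [NormedSpace ℝ E]
    (hK : IsCompact K) (hμ : ∀ᵐ y ∂μ, y ∈ K) {f : P → Y → E}
    (hf : ContDiff ℝ ∞ fun q : P × Y => f q.1 q.2) :
    ContDiff ℝ ∞ fun p => ∫ y, f p y ∂μ := by
  refine contDiff_infty.2 fun n => ?_
  induction n generalizing E with
  | zero =>
    exact contDiff_zero.2 (continuous_iff_continuousAt.2 fun p =>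
      (hasFDerivAt_integral_of_contDiff hK hμ hf p).continuousAt)
  | succ n ih =>
    refine (contDiff_succ_iff_hasFDerivAt (n := n)).2 ⟨_, ?_,
      fun p => hasFDerivAt_integral_of_contDiff hK hμ hf p⟩
    exact ih (f := fun p y => (fderiv ℝ (fun q : P × Y => f q.1 q.2) (p, y)).comp
      (ContinuousLinearMap.inl ℝ P Y))
      ((hf.fderiv_right (m := ∞) (by simp)).clm_comp contDiff_const)

end Parametric

theorem isCompact_closedBall_plane : IsCompact (Metric.closedBall (0 : Plane) 2) :=
  isCompact_closedBall _ _

theorem cell_subset_closedBall : cell ⊆ Metric.closedBall (0 : Plane) 2 := fun u hu => by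
  have h : ∀ i, u i ^ 2 ≤ 1 := fun i => by
    have := hu i
    exact pow_le_one₀ this.1 this.2.le
  rw [mem_closedBall_zero_iff, EuclideanSpace.norm_eq, Real.sqrt_le_left (by norm_num),
    Fin.sum_univ_two]
  simp only [Real.norm_eq_abs, sq_abs]
  linarith [h 0, h 1]

theorem ae_mem_closedBall :
    ∀ᵐ u ∂(volume.restrict cell : Measure Plane), u ∈ Metric.closedBall (0 : Plane) 2 :=
  (ae_restrict_mem measurableSet_cell).mono fun _ hu => cell_subset_closedBall hu

theorem integrableOn_cell {E : Type*} [NormedAddCommGroup E] {f : Plane → E}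
    (hf : Continuous f) : IntegrableOn f cell :=
  integrable_of_continuous_of_isCompact isCompact_closedBall_plane ae_mem_closedBall hf

/-! ### The area form as a continuous bilinear map and primitives of closed one-forms -/

/-- The area form as a continuous bilinear map. -/
def areaFormL : Plane →L[ℝ] Plane →L[ℝ] ℝ :=
  (EuclideanSpace.proj 0 : Plane →L[ℝ] ℝ).smulRight (EuclideanSpace.proj 1) -
    (EuclideanSpace.proj 1 : Plane →L[ℝ] ℝ).smulRight (EuclideanSpace.proj 0)

theorem areaFormL_apply (v w : Plane) : areaFormL v w = areaForm v w := by
  simp [areaFormL, areaForm]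

/-- The average of the derivative of a function along a vector, when this derivative is periodic. -/
theorem setIntegral_cell_fderiv_apply {k : Plane → ℝ} (hk : ContDiff ℝ ∞ k) (v : Plane)
    (hper : ∀ u m, fderiv ℝ k (u + latticePt m) v = fderiv ℝ k u v) :
    ∫ u in cell, (k (u + v) - k u) = ∫ u in cell, fderiv ℝ k u v := by
  have hq : Continuous fun u => fderiv ℝ k u v :=
    (hk.continuous_fderiv (by simp)).clm_apply continuous_const
  have hline : ∀ u, k (u + v) - k u = ∫ s in (0 : ℝ)..1, fderiv ℝ k (u + s • v) v := fun u => by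
    rw [intervalIntegral.integral_eq_sub_of_hasDerivAt (f := fun s : ℝ => k (u + s • v))]
    · simp
    · intro s _
      have h : HasDerivAt (fun s : ℝ => u + s • v) v s := by
        simpa using ((hasDerivAt_id s).smul_const v).const_add u
      exact (hk.differentiable (by simp) _).hasFDerivAt.comp_hasDerivAt s h
    · exact (hq.comp (by fun_prop)).intervalIntegrable _ _
  simp only [hline, intervalIntegral.integral_of_le zero_le_one]
  -- After the swap, the integral over the cell does not depend on `s`, by translation invariance of
  -- averages of periodic functions.
  rw [integral_integral_swap]
  · simp only [setIntegral_cell_comp_add hq hper]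
    simp
  · have : IsFiniteMeasure ((volume.restrict cell).prod (volume.restrict (Ioc (0 : ℝ) 1))) :=
      inferInstance
    refine integrable_of_continuous_of_isCompact
      (K := Metric.closedBall (0 : Plane) 2 ×ˢ Icc (0 : ℝ) 1)
      (isCompact_closedBall_plane.prod isCompact_Icc) ?_ (hq.comp (by fun_prop))
    rw [Measure.prod_restrict]
    refine (ae_restrict_mem (measurableSet_cell.prod measurableSet_Ioc)).mono fun p hp => ?_
    exact ⟨cell_subset_closedBall hp.1, Ioc_subset_Icc_self hp.2⟩

/-- The primitive, vanishing at the origin, of the one-form `areaForm X ·`. -/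
def primitive (X : Plane → Plane) (u : Plane) : ℝ :=
  ∫ s in Ioc (0 : ℝ) 1, areaForm (X (s • u)) u

theorem contDiff_primitive {X : ℝ × Plane → Plane} (hX : ContDiff ℝ ∞ X) :
    ContDiff ℝ ∞ fun p : ℝ × Plane => primitive (fun u => X (p.1, u)) p.2 := by
  refine contDiff_integral_of_contDiff (K := Icc (0 : ℝ) 1) isCompact_Icc
    ((ae_restrict_mem measurableSet_Ioc).mono fun _ h => Ioc_subset_Icc_self h)
    (f := fun (p : ℝ × Plane) s => areaForm (X (p.1, s • p.2)) p.2) ?_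
  simp only [← areaFormL_apply]
  have h : ContDiff ℝ ∞ fun q : (ℝ × Plane) × ℝ => X (q.1.1, q.2 • q.1.2) :=
    hX.comp (by fun_prop)
  exact (areaFormL.contDiff.comp h).clm_apply (by fun_prop)

/-- The Poincaré lemma on the plane: `hsymm` says that the one-form `areaForm X ·` is closed. -/
theorem hasFDerivAt_primitive {X : Plane → Plane} (hX : ContDiff ℝ ∞ X)
    (hsymm : ∀ u a b, areaForm (fderiv ℝ X u a) b = areaForm (fderiv ℝ X u b) a) (u : Plane) :
    HasFDerivAt (primitive X) (areaFormL (X u)) u := by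
  have hf : ContDiff ℝ ∞ fun q : Plane × ℝ => areaForm (X (q.2 • q.1)) q.1 := by
    simp only [← areaFormL_apply]
    have h : ContDiff ℝ ∞ fun q : Plane × ℝ => X (q.2 • q.1) := hX.comp (by fun_prop)
    exact (areaFormL.contDiff.comp h).clm_apply (by fun_prop)
  have hμ : ∀ᵐ s ∂(volume.restrict (Ioc (0 : ℝ) 1)), s ∈ Icc (0 : ℝ) 1 :=
    (ae_restrict_mem measurableSet_Ioc).mono fun _ h => Ioc_subset_Icc_self h
  have hd := hasFDerivAt_integral_of_contDiff isCompact_Icc hμ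
    (f := fun u s => areaForm (X (s • u)) u) hf u
  refine hd.congr_fderiv ?_
  ext v
  have hcont : Continuous fun s : ℝ =>
      (fderiv ℝ (fun q : Plane × ℝ => areaForm (X (q.2 • q.1)) q.1) (u, s)).comp
        (ContinuousLinearMap.inl ℝ Plane ℝ) :=
    ((hf.continuous_fderiv (by simp)).comp (by fun_prop)).clm_comp continuous_const
  rw [ContinuousLinearMap.integral_apply
    (integrable_of_continuous_of_isCompact isCompact_Icc hμ hcont)]
  -- By closedness, the derivative of the integrand in the direction `v` is a total derivative in
  -- `s`, so its integral is a boundary term.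
  have hder : ∀ s : ℝ, HasDerivAt (fun s : ℝ => s * areaForm (X (s • u)) v)
      ((fderiv ℝ (fun q : Plane × ℝ => areaForm (X (q.2 • q.1)) q.1) (u, s)).comp
        (ContinuousLinearMap.inl ℝ Plane ℝ) v) s := fun s => by
    have hXd : HasFDerivAt X (fderiv ℝ X (s • u)) (s • u) :=
      (hX.differentiable (by simp) _).hasFDerivAt
    have h0 : HasFDerivAt (fun u : Plane => s • u) (s • ContinuousLinearMap.id ℝ Plane) u :=
      (hasFDerivAt_id u).const_smul s
    have h1 : HasFDerivAt (fun u : Plane => areaFormL (X (s • u)) u) _ u :=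
      (areaFormL.hasFDerivAt.comp u (hXd.comp u h0)).clm_apply (hasFDerivAt_id u)
    have h2 : HasFDerivAt (fun u : Plane => areaFormL (X (s • u)) u)
        ((fderiv ℝ (fun q : Plane × ℝ => areaForm (X (q.2 • q.1)) q.1) (u, s)).comp
          (ContinuousLinearMap.inl ℝ Plane ℝ)) u := by
      have hl : HasFDerivAt (fun u : Plane => (u, s)) (ContinuousLinearMap.inl ℝ Plane ℝ) u :=
        hasFDerivAt_prodMk_left u s
      have := HasFDerivAt.comp u (hf.differentiable (by simp) (u, s)).hasFDerivAt hl
      simp only [← areaFormL_apply] at this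
      exact this
    have h3 : HasDerivAt (fun s : ℝ => s • u) u s := by
      simpa using (hasDerivAt_id s).smul_const u
    have h4 : HasDerivAt (fun s : ℝ => s * areaFormL (X (s • u)) v) _ s :=
      (hasDerivAt_id s).mul ((areaFormL.hasFDerivAt.comp_hasDerivAt s
        (hXd.comp_hasDerivAt s h3)).clm_apply (hasDerivAt_const s v))
    have h5 := DFunLike.congr_fun (h1.unique h2) v
    simp only [← areaFormL_apply] at hsymm ⊢
    refine h4.congr_deriv ?_
    refine Eq.trans ?_ h5
    simp [hsymm _ v u]
  rw [← intervalIntegral.integral_of_le zero_le_one,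
    intervalIntegral.integral_eq_sub_of_hasDerivAt (fun s _ => hder s)
      ((hcont.clm_apply continuous_const).intervalIntegrable _ _)]
  simp [areaFormL_apply]

namespace Isotopy

/-! ### Lifts of isotopies -/

variable (g : Isotopy)

/-- The time derivative of the lift of an isotopy. -/
def timeDeriv (t : ℝ) (u : Plane) : Plane :=
  derivWithin (fun s => g.lift s u) (Icc 0 1) t

theorem velocity_eq (t : ℝ) (x : Torus) :
    g.velocity t x = g.timeDeriv t (rep ((g.map t)⁻¹ x)) := rfl

theorem uniqueDiffOn_Icc_prod_univ : UniqueDiffOn ℝ (Icc (0 : ℝ) 1 ×ˢ (univ : Set Plane)) :=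
  (uniqueDiffOn_Icc zero_lt_one).prod uniqueDiffOn_univ

variable {t : ℝ} (ht : t ∈ Icc (0 : ℝ) 1)

include ht

theorem hasDerivWithinAt_lift_fderivWithin (u : Plane) :
    HasDerivWithinAt (fun s => g.lift s u)
      (fderivWithin ℝ (fun p : ℝ × Plane => g.lift p.1 p.2) (Icc 0 1 ×ˢ univ) (t, u) (1, 0))
      (Icc 0 1) t := by
  have h1 : HasDerivWithinAt (fun s : ℝ => (s, u)) (1, 0) (Icc 0 1) t :=
    (hasDerivWithinAt_id t _).prodMk (hasDerivWithinAt_const t _ u)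
  have h2 := (g.smooth.differentiableOn (by simp) (t, u) ⟨ht, mem_univ u⟩).hasFDerivWithinAt
  exact h2.comp_hasDerivWithinAt t h1 fun s hs => mk_mem_prod hs (mem_univ u)

theorem hasDerivWithinAt_lift (u : Plane) :
    HasDerivWithinAt (fun s => g.lift s u) (g.timeDeriv t u) (Icc 0 1) t :=
  (g.hasDerivWithinAt_lift_fderivWithin ht u).differentiableWithinAt.hasDerivWithinAt

theorem timeDeriv_eq_fderivWithin (u : Plane) : g.timeDeriv t u =
    fderivWithin ℝ (fun p : ℝ × Plane => g.lift p.1 p.2) (Icc 0 1 ×ˢ univ) (t, u) (1, 0) :=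
  (g.hasDerivWithinAt_lift_fderivWithin ht u).derivWithin (uniqueDiffOn_Icc zero_lt_one t ht)

theorem contDiff_lift : ContDiff ℝ ∞ (g.lift t) := by
  rw [← contDiffOn_univ]
  exact g.smooth.comp (f := fun u => (t, u)) (by fun_prop) fun u _ => ⟨ht, mem_univ u⟩

omit ht

theorem continuousOn_timeDeriv :
    ContinuousOn (fun p : ℝ × Plane => g.timeDeriv p.1 p.2) (Icc 0 1 ×ˢ univ) := by
  refine ContinuousOn.congr ?_ fun p hp => g.timeDeriv_eq_fderivWithin hp.1 p.2
  exact (g.smooth.continuousOn_fderivWithin uniqueDiffOn_Icc_prod_univ (by simp)).clm_apply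
    continuousOn_const

theorem exists_lift_zero_eq : ∃ m, ∀ u, g.lift 0 u = u + latticePt m := by
  have h0 : (0 : ℝ) ∈ Icc (0 : ℝ) 1 := by simp
  have h := g.isLift 0 h0
  rw [g.map_zero] at h
  exact h.exists_eq_add isLift_id (g.contDiff_lift h0).continuous continuous_id

include ht

theorem continuous_timeDeriv : Continuous (g.timeDeriv t) := by
  rw [← continuousOn_univ]
  exact g.continuousOn_timeDeriv.comp (f := fun u => (t, u)) (by fun_prop)
    fun u _ => ⟨ht, mem_univ u⟩

/-- The difference of the two lifted paths is lattice-valued and continuous in time, so it keeps its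
value at time 0, where the lift is a translation. -/
theorem lift_add_latticePt (u : Plane) (m : Fin 2 → ℤ) :
    g.lift t (u + latticePt m) = g.lift t u + latticePt m := by
  have h0 : (0 : ℝ) ∈ Icc (0 : ℝ) 1 := by simp
  have : PreconnectedSpace (Icc (0 : ℝ) 1) := Subtype.preconnectedSpace isPreconnected_Icc
  have hcont : ∀ v, Continuous fun s : Icc (0 : ℝ) 1 => g.lift s v := fun v => by
    refine g.smooth.continuousOn.comp_continuous (f := fun s : Icc (0 : ℝ) 1 => ((s : ℝ), v))
      (by fun_prop) fun s => ⟨s.2, mem_univ v⟩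
  have h := eq_of_continuous_of_mem_range_latticePt
    (c := fun s : Icc (0 : ℝ) 1 => g.lift s (u + latticePt m) - g.lift s u)
    ((hcont _).sub (hcont _)) (fun s => proj_eq_zero_iff.1 (by
      rw [proj_sub, g.isLift s s.2, g.isLift s s.2, proj_add_latticePt, sub_self]))
    ⟨t, ht⟩ ⟨0, h0⟩
  obtain ⟨n, hn⟩ := g.exists_lift_zero_eq
  simp only [hn] at h
  rw [sub_eq_iff_eq_add] at h
  rw [h]
  abel

theorem timeDeriv_add_latticePt (u : Plane) (m : Fin 2 → ℤ) :
    g.timeDeriv t (u + latticePt m) = g.timeDeriv t u := by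
  have h : HasDerivWithinAt (fun s => g.lift s (u + latticePt m)) (g.timeDeriv t u)
      (Icc 0 1) t := by
    refine ((g.hasDerivWithinAt_lift ht u).add_const (latticePt m)).congr_of_mem
      (fun s hs => g.lift_add_latticePt hs u m) ht
  exact h.derivWithin (uniqueDiffOn_Icc zero_lt_one t ht)

theorem velocity_proj_lift (u : Plane) :
    g.velocity t (proj (g.lift t u)) = g.timeDeriv t u := by
  rw [velocity_eq, g.isLift t ht, show (g.map t)⁻¹ (g.map t (proj u)) = proj u from
    (g.map t).symm_apply_apply _]
  obtain ⟨m, hm⟩ := exists_eq_rep_add u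
  conv_rhs => rw [hm, g.timeDeriv_add_latticePt ht]

theorem lintegral_velocity :
    ∫⁻ x : Torus, ‖g.velocity t x‖ₑ = ∫⁻ u in cell, ‖g.timeDeriv t u‖ₑ := by
  simp only [velocity_eq]
  rw [lintegral_comp_of_mem_areaDiff (inv_mem_areaDiff (g.map_mem t ht))
    fun x => ‖g.timeDeriv t (rep x)‖ₑ]
  exact measurePreserving_rep.lintegral_comp (g.continuous_timeDeriv ht).enorm.measurable

omit ht

theorem length_eq : g.length = ∫⁻ t in Icc (0 : ℝ) 1, ∫⁻ u in cell, ‖g.timeDeriv t u‖ₑ :=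
  setLIntegral_congr_fun measurableSet_Icc fun _ ht => g.lintegral_velocity ht

theorem length_lt_top : g.length < ⊤ := by
  obtain ⟨C, hC⟩ := (isCompact_Icc.prod isCompact_closedBall_plane).exists_bound_of_continuousOn
    (g.continuousOn_timeDeriv.mono (prod_mono_right (subset_univ (Metric.closedBall 0 2))))
  rw [length_eq]
  calc ∫⁻ t in Icc (0 : ℝ) 1, ∫⁻ u in cell, ‖g.timeDeriv t u‖ₑ
      ≤ ∫⁻ t in Icc (0 : ℝ) 1, ∫⁻ u in cell, ENNReal.ofReal C := by
        refine setLIntegral_mono measurable_const fun t ht => ?_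
        refine setLIntegral_mono measurable_const fun u hu => ?_
        rw [← ofReal_norm]
        exact ENNReal.ofReal_le_ofReal (hC (t, u) ⟨ht, cell_subset_closedBall hu⟩)
    _ < ⊤ := by simp

/-- The flux of an isotopy: the average displacement of the points of the plane. -/
def flux : Plane := ∫ u in cell, (g.lift 1 u - g.lift 0 u)

/-! ### Constructions of isotopies -/

/-- The isotopy `t ↦ φ_{σ t}`. -/
def reparam (σ : ℝ → ℝ) (hσ : ContDiff ℝ ∞ σ) (hmaps : MapsTo σ (Icc 0 1) (Icc 0 1))
    (h0 : σ 0 = 0) : Isotopy where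
  map t := g.map (σ t)
  lift t := g.lift (σ t)
  map_mem t ht := g.map_mem _ (hmaps ht)
  map_zero := by rw [h0, g.map_zero]
  smooth := g.smooth.comp (f := fun p : ℝ × Plane => (σ p.1, p.2))
    ((hσ.comp contDiff_fst).prodMk contDiff_snd).contDiffOn fun p hp => ⟨hmaps hp.1, mem_univ _⟩
  isLift t ht := g.isLift _ (hmaps ht)

/-- The isotopy `t ↦ T_{w t} ∘ φ_t`, with `T_v` the translation by `v`. -/
def translate (w : ℝ → Plane) (hw : ContDiff ℝ ∞ w) (h0 : w 0 = 0) : Isotopy where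
  map t := Equiv.addRight (proj (w t)) * g.map t
  lift t u := g.lift t u + w t
  map_mem t ht := mul_mem_areaDiff (addRight_mem_areaDiff _) (g.map_mem t ht)
  map_zero := by
    rw [h0, proj_zero, g.map_zero]
    ext1 x
    simp
  smooth := g.smooth.add (hw.comp contDiff_fst).contDiffOn
  isLift t ht := (isLift_add (w t)).comp (g.isLift t ht)

/-- The witness is $h_t\circ g_{1-t}\circ g_1^{-1}$. Unlike $h_t\circ g_t^{-1}$, it inverts a single
map, so no smoothness of inverses in time is needed. -/
theorem exists_mul_inv (h : Isotopy) : ∃ k : Isotopy,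
    k.map 1 = h.map 1 * (g.map 1)⁻¹ ∧ k.flux = h.flux - g.flux := by
  have m0 : (0 : ℝ) ∈ Icc (0 : ℝ) 1 := by simp
  have m1 : (1 : ℝ) ∈ Icc (0 : ℝ) 1 := by simp
  have hinv := inv_mem_areaDiff (g.map_mem 1 m1)
  obtain ⟨A, hA, hAl⟩ := hinv.1.isSmooth
  have hsub : ∀ t ∈ Icc (0 : ℝ) 1, 1 - t ∈ Icc (0 : ℝ) 1 := fun t ht =>
    ⟨by linarith [ht.2], by linarith [ht.1]⟩
  refine ⟨{ map := fun t => h.map t * (g.map (1 - t) * (g.map 1)⁻¹)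
            lift := fun t u => h.lift t (g.lift (1 - t) (A u))
            map_mem := fun t ht => mul_mem_areaDiff (h.map_mem t ht)
              (mul_mem_areaDiff (g.map_mem _ (hsub t ht)) hinv)
            map_zero := by simp [h.map_zero]
            smooth := ?_
            isLift := fun t ht =>
              (h.isLift t ht).comp ((g.isLift _ (hsub t ht)).comp hAl) }, ?_, ?_⟩
  · have h1 : ContDiffOn ℝ ∞ (fun p : ℝ × Plane => g.lift (1 - p.1) (A p.2))
        (Icc 0 1 ×ˢ univ) :=
      g.smooth.comp (f := fun p : ℝ × Plane => (1 - p.1, A p.2))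
        ((contDiff_const.sub contDiff_fst).prodMk (hA.comp contDiff_snd)).contDiffOn
        fun p hp => ⟨hsub _ hp.1, mem_univ _⟩
    exact h.smooth.comp (contDiff_fst.contDiffOn.prodMk h1) fun p hp => ⟨hp.1, mem_univ _⟩
  · simp [g.map_zero]
  · obtain ⟨m, hm⟩ := h.exists_lift_zero_eq
    have hc : ∀ (k : Isotopy), Continuous fun u => k.lift 1 u - k.lift 0 u := fun k =>
      (k.contDiff_lift m1).continuous.sub (k.contDiff_lift m0).continuous
    have hper : ∀ (k : Isotopy) u m, k.lift 1 (u + latticePt m) - k.lift 0 (u + latticePt m)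
        = k.lift 1 u - k.lift 0 u := fun k u m => by
      rw [k.lift_add_latticePt m1, k.lift_add_latticePt m0, add_sub_add_right_eq_sub]
    have hB : IsLift (g.lift 0 ∘ A) ⇑(g.map 1)⁻¹ := by
      have := (g.isLift 0 m0).comp hAl
      rwa [g.map_zero] at this
    have hBc : Continuous (g.lift 0 ∘ A) :=
      (g.contDiff_lift m0).continuous.comp hA.continuous
    -- The displacement splits into those of `h` and `g` at moved points; area preservation removes
    -- the moves from the averages.
    have hdec : ∀ u, h.lift 1 (g.lift (1 - 1) (A u)) - h.lift 0 (g.lift (1 - 0) (A u)) =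
        (h.lift 1 ((g.lift 0 ∘ A) u) - h.lift 0 ((g.lift 0 ∘ A) u)) -
          (g.lift 1 (A u) - g.lift 0 (A u)) := fun u => by
      simp only [sub_self, sub_zero, Function.comp_apply, hm]
      abel
    simp only [flux, hdec]
    rw [integral_sub (f := fun u => h.lift 1 ((g.lift 0 ∘ A) u) - h.lift 0 ((g.lift 0 ∘ A) u))
      (g := fun u => g.lift 1 (A u) - g.lift 0 (A u)) (integrableOn_cell ((hc h).comp hBc))
      (integrableOn_cell ((hc g).comp hA.continuous)),
      setIntegral_cell_comp_isLift hinv hBc hB (hc h) (hper h),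
      setIntegral_cell_comp_isLift hinv hA.continuous hAl (hc g) (hper g)]

/-- Run the isotopy only up to time `t`. Thus the condition of staying in `diff0` in `l1Dist` holds
for every isotopy. -/
theorem map_mem_diff0 (ht : t ∈ Icc (0 : ℝ) 1) : g.map t ∈ diff0 :=
  ⟨g.reparam (fun s => s * t) (by fun_prop)
    (fun s hs => ⟨mul_nonneg hs.1 ht.1, mul_le_one₀ hs.2 ht.1 ht.2⟩) (zero_mul t), by
      simp [reparam]⟩

/-! ### Velocity, length and Hamiltonians under reparametrisation and translation. -/

theorem timeDeriv_reparam {σ : ℝ → ℝ} (hσ : ContDiff ℝ ∞ σ)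
    (hmaps : MapsTo σ (Icc 0 1) (Icc 0 1)) (h0 : σ 0 = 0) (ht : t ∈ Icc (0 : ℝ) 1) (u : Plane) :
    (g.reparam σ hσ hmaps h0).timeDeriv t u = deriv σ t • g.timeDeriv (σ t) u := by
  have h1 : HasDerivWithinAt σ (deriv σ t) (Icc 0 1) t :=
    (hσ.differentiable (by simp) t).hasDerivAt.hasDerivWithinAt
  exact ((g.hasDerivWithinAt_lift (hmaps ht) u).scomp t h1 hmaps).derivWithin
    (uniqueDiffOn_Icc zero_lt_one t ht)

theorem timeDeriv_translate {w : ℝ → Plane} (hw : ContDiff ℝ ∞ w) (h0 : w 0 = 0)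
    (ht : t ∈ Icc (0 : ℝ) 1) (u : Plane) :
    (g.translate w hw h0).timeDeriv t u = g.timeDeriv t u + deriv w t := by
  have h1 : HasDerivWithinAt w (deriv w t) (Icc 0 1) t :=
    (hw.differentiable (by simp) t).hasDerivAt.hasDerivWithinAt
  exact ((g.hasDerivWithinAt_lift ht u).add h1).derivWithin (uniqueDiffOn_Icc zero_lt_one t ht)

theorem length_reparam_le {σ : ℝ → ℝ} (hσ : ContDiff ℝ ∞ σ)
    (hmaps : MapsTo σ (Icc 0 1) (Icc 0 1)) (h0 : σ 0 = 0) (hmono : Monotone σ) :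
    (g.reparam σ hσ hmaps h0).length ≤ g.length := by
  rw [length_eq, length_eq]
  calc ∫⁻ t in Icc (0 : ℝ) 1, ∫⁻ u in cell, ‖(g.reparam σ hσ hmaps h0).timeDeriv t u‖ₑ
      = ∫⁻ t in Icc (0 : ℝ) 1,
          ENNReal.ofReal (deriv σ t) * ∫⁻ u in cell, ‖g.timeDeriv (σ t) u‖ₑ := by
        refine setLIntegral_congr_fun measurableSet_Icc fun t ht => ?_
        simp only [g.timeDeriv_reparam hσ hmaps h0 ht, enorm_smul]
        rw [lintegral_const_mul _ (g.continuous_timeDeriv (hmaps ht)).enorm.measurable,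
          Real.enorm_of_nonneg hmono.deriv_nonneg]
    _ = ∫⁻ t in σ '' Icc (0 : ℝ) 1, ∫⁻ u in cell, ‖g.timeDeriv t u‖ₑ :=
        (lintegral_image_eq_lintegral_deriv_mul_of_monotoneOn measurableSet_Icc
          (fun t _ => (hσ.differentiable (by simp) t).hasDerivAt.hasDerivWithinAt)
          (hmono.monotoneOn _) fun t => ∫⁻ u in cell, ‖g.timeDeriv t u‖ₑ).symm
    _ ≤ _ := lintegral_mono_set hmaps.image_subset

theorem IsHamiltonian.reparam {g : Isotopy} (hg : g.IsHamiltonian) {σ : ℝ → ℝ}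
    (hσ : ContDiff ℝ ∞ σ) (hmaps : MapsTo σ (Icc 0 1) (Icc 0 1)) (h0 : σ 0 = 0) :
    (g.reparam σ hσ hmaps h0).IsHamiltonian := by
  obtain ⟨H, hH, hv⟩ := hg
  refine ⟨fun t x => deriv σ t * H (σ t) x, ?_, fun t ht u v => ?_⟩
  · have h1 : ContDiff ℝ ∞ (deriv σ) := (contDiff_infty_iff_deriv.1 hσ).2
    exact (h1.comp contDiff_fst).contDiffOn.mul
      (hH.comp (f := fun p : ℝ × Plane => (σ p.1, p.2))
        ((hσ.comp contDiff_fst).prodMk contDiff_snd).contDiffOn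
        fun p hp => ⟨hmaps hp.1, mem_univ _⟩)
  · have hd : DifferentiableAt ℝ (fun w => H (σ t) (proj w)) u := by
      have : ContDiff ℝ ∞ fun w => H (σ t) (proj w) := by
        rw [← contDiffOn_univ]
        exact hH.comp (f := fun u => (σ t, u)) (by fun_prop) fun u _ => ⟨hmaps ht, mem_univ u⟩
      exact this.differentiable (by simp) u
    rw [fderiv_const_mul hd, smul_apply, ← hv _ (hmaps ht), velocity_eq,
      velocity_eq, g.timeDeriv_reparam hσ hmaps h0 ht]
    simp [areaForm, Isotopy.reparam]
    ring

theorem IsHamiltonian.map_mem_ham {g : Isotopy} (hg : g.IsHamiltonian)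
    (ht : t ∈ Icc (0 : ℝ) 1) : g.map t ∈ ham :=
  ⟨g.reparam (fun s => s * t) (by fun_prop)
    (fun s hs => ⟨mul_nonneg hs.1 ht.1, mul_le_one₀ hs.2 ht.1 ht.2⟩) (zero_mul t),
    hg.reparam _ _ _, by simp [Isotopy.reparam]⟩

end Isotopy

/-! ### Families of area-preserving maps of the plane -/

section Family

variable {F : ℝ × Plane → Plane} (hF : ContDiff ℝ ∞ F)

include hF

theorem hasFDerivAt_fderiv_of_contDiff (p : ℝ × Plane) :
    HasFDerivAt (fderiv ℝ F) (fderiv ℝ (fderiv ℝ F) p) p :=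
  ((hF.fderiv_right (m := ∞) (by simp)).differentiable (by simp) p).hasFDerivAt

theorem areaForm_fderiv_fderiv (hω : ∀ p v w,
      areaForm (fderiv ℝ F p (0, v)) (fderiv ℝ F p (0, w)) = areaForm v w)
    (p : ℝ × Plane) (v w : Plane) :
    areaForm (fderiv ℝ (fderiv ℝ F) p (1, 0) (0, v)) (fderiv ℝ F p (0, w)) +
      areaForm (fderiv ℝ F p (0, v)) (fderiv ℝ (fderiv ℝ F) p (1, 0) (0, w)) = 0 := by
  have hl : HasDerivAt (fun s : ℝ => (s, p.2)) ((1 : ℝ), (0 : Plane)) p.1 :=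
    (hasDerivAt_id p.1).prodMk (hasDerivAt_const p.1 p.2)
  have h0 : HasDerivAt (fun s => fderiv ℝ F (s, p.2)) (fderiv ℝ (fderiv ℝ F) p (1, 0)) p.1 :=
    HasFDerivAt.comp_hasDerivAt (f := fun s : ℝ => (s, p.2)) p.1
      (hasFDerivAt_fderiv_of_contDiff hF (p.1, p.2)) hl
  have h1 : ∀ v : Plane, HasDerivAt (fun s => fderiv ℝ F (s, p.2) (0, v))
      (fderiv ℝ (fderiv ℝ F) p (1, 0) (0, v)) p.1 := fun v => by
    have h := h0.clm_apply (hasDerivAt_const p.1 ((0 : ℝ), v))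
    rwa [map_zero, add_zero] at h
  have h2 : HasDerivAt (fun s => areaFormL (fderiv ℝ F (s, p.2) (0, v))
      (fderiv ℝ F (s, p.2) (0, w))) _ p.1 :=
    (areaFormL.hasFDerivAt.comp_hasDerivAt p.1 (h1 v)).clm_apply (h1 w)
  have h3 : HasDerivAt (fun s => areaFormL (fderiv ℝ F (s, p.2) (0, v))
      (fderiv ℝ F (s, p.2) (0, w))) 0 p.1 := by
    simp only [areaFormL_apply, hω]
    exact hasDerivAt_const p.1 _
  have h4 := h2.unique h3
  simp only [areaFormL_apply] at h4
  exact h4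

theorem fderiv_velocity_apply {X : ℝ × Plane → Plane} (hX : ContDiff ℝ ∞ X)
    (hXF : ∀ t u, X (t, F (t, u)) = fderiv ℝ F (t, u) (1, 0)) (t : ℝ) (u v : Plane) :
    fderiv ℝ (fun u => X (t, u)) (F (t, u)) (fderiv ℝ F (t, u) (0, v)) =
      fderiv ℝ (fderiv ℝ F) (t, u) (0, v) (1, 0) := by
  have hr : HasFDerivAt (fun u : Plane => (t, u)) (ContinuousLinearMap.inr ℝ ℝ Plane) u :=
    hasFDerivAt_prodMk_right t u
  have hXt : HasFDerivAt (fun u => X (t, u)) (fderiv ℝ (fun u => X (t, u)) (F (t, u)))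
      (F (t, u)) :=
    ((hX.comp (by fun_prop : ContDiff ℝ ∞ fun u : Plane => (t, u))).differentiable
      (by simp) _).hasFDerivAt
  have hFt : HasFDerivAt (fun u => F (t, u)) _ u :=
    HasFDerivAt.comp u (hF.differentiable (by simp) (t, u)).hasFDerivAt hr
  have h1 : HasFDerivAt (fun u => X (t, F (t, u))) _ u :=
    HasFDerivAt.comp (g := fun u => X (t, u)) u hXt hFt
  have h2 : HasFDerivAt (fun u => fderiv ℝ F (t, u) (1, 0)) _ u :=
    (HasFDerivAt.comp u (hasFDerivAt_fderiv_of_contDiff hF (t, u)) hr).clm_apply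
      (hasFDerivAt_const ((1 : ℝ), (0 : Plane)) u)
  simp only [hXF] at h1
  have h3 := DFunLike.congr_fun (h1.unique h2) v
  simpa using h3

end Family

theorem areaForm_latticePt_snd (v : Plane) : areaForm v (latticePt ![0, 1]) = v 0 := by
  simp [areaForm]

theorem areaForm_latticePt_fst (v : Plane) : areaForm v (latticePt ![-1, 0]) = v 1 := by
  simp [areaForm]

namespace Isotopy

/-! ### Isotopies that extend smoothly to all times -/

/-- The isotopy is a smooth family of area-preserving diffeomorphisms for all real times. -/
structure IsComplete (g : Isotopy) : Prop where
  contDiff : ContDiff ℝ ∞ fun p : ℝ × Plane => g.lift p.1 p.2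
  map_mem : ∀ t, g.map t ∈ areaDiff
  isLift : ∀ t, IsLift (g.lift t) (g.map t)
  lift_add : ∀ t u m, g.lift t (u + latticePt m) = g.lift t u + latticePt m

/-- Since `σ` sends all of `ℝ` into `[0, 1]`, the unconstrained values of `g` at other times are
never used. -/
theorem isComplete_reparam (g : Isotopy) {σ : ℝ → ℝ} (hσ : ContDiff ℝ ∞ σ)
    (hmaps : ∀ t, σ t ∈ Icc (0 : ℝ) 1) (h0 : σ 0 = 0) :
    (g.reparam σ hσ (fun t _ => hmaps t) h0).IsComplete where
  contDiff := by
    rw [← contDiffOn_univ]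
    exact g.smooth.comp (f := fun p : ℝ × Plane => (σ p.1, p.2))
      ((hσ.comp contDiff_fst).prodMk contDiff_snd).contDiffOn
      fun p _ => ⟨hmaps _, mem_univ _⟩
  map_mem t := g.map_mem _ (hmaps t)
  isLift t := g.isLift _ (hmaps t)
  lift_add t := g.lift_add_latticePt (hmaps t)

namespace IsComplete

variable {g : Isotopy} (hg : g.IsComplete)

include hg

theorem translate {w : ℝ → Plane} (hw : ContDiff ℝ ∞ w) (h0 : w 0 = 0) :
    (g.translate w hw h0).IsComplete where
  contDiff := hg.contDiff.add (hw.comp contDiff_fst)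
  map_mem t := mul_mem_areaDiff (addRight_mem_areaDiff _) (hg.map_mem t)
  isLift t := (isLift_add (w t)).comp (hg.isLift t)
  lift_add t u m := by
    simp only [Isotopy.translate, hg.lift_add]
    abel

theorem hasFDerivAt (p : ℝ × Plane) : HasFDerivAt (fun p : ℝ × Plane => g.lift p.1 p.2)
    (fderiv ℝ (fun p : ℝ × Plane => g.lift p.1 p.2) p) p :=
  (hg.contDiff.differentiable (by simp) p).hasFDerivAt

theorem hasFDerivAt_lift (t : ℝ) (u : Plane) : HasFDerivAt (g.lift t)
    ((fderiv ℝ (fun p : ℝ × Plane => g.lift p.1 p.2) (t, u)).comp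
      (ContinuousLinearMap.inr ℝ ℝ Plane)) u := by
  have h : HasFDerivAt (fun u : Plane => (t, u)) (ContinuousLinearMap.inr ℝ ℝ Plane) u :=
    hasFDerivAt_prodMk_right t u
  exact HasFDerivAt.comp u (hg.hasFDerivAt (t, u)) h

theorem hasDerivAt_lift (t : ℝ) (u : Plane) : HasDerivAt (fun s => g.lift s u)
    (fderiv ℝ (fun p : ℝ × Plane => g.lift p.1 p.2) (t, u) (1, 0)) t := by
  have h : HasDerivAt (fun s : ℝ => (s, u)) (1, 0) t :=
    (hasDerivAt_id t).prodMk (hasDerivAt_const t u)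
  exact (hg.hasFDerivAt (t, u)).comp_hasDerivAt t h

theorem timeDeriv_eq {t : ℝ} (ht : t ∈ Icc (0 : ℝ) 1) (u : Plane) : g.timeDeriv t u =
    fderiv ℝ (fun p : ℝ × Plane => g.lift p.1 p.2) (t, u) (1, 0) :=
  (hg.hasDerivAt_lift t u).hasDerivWithinAt.derivWithin (uniqueDiffOn_Icc zero_lt_one t ht)

theorem areaForm_fderiv (p : ℝ × Plane) (v w : Plane) :
    areaForm (fderiv ℝ (fun p : ℝ × Plane => g.lift p.1 p.2) p (0, v))
      (fderiv ℝ (fun p : ℝ × Plane => g.lift p.1 p.2) p (0, w)) = areaForm v w := by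
  have h := (hg.hasFDerivAt_lift p.1 p.2).fderiv
  have hc : Continuous (g.lift p.1) :=
    continuous_iff_continuousAt.2 fun u => (hg.hasFDerivAt_lift p.1 u).continuousAt
  rw [← (hg.map_mem p.1).1.areaForm_fderiv hc (hg.isLift p.1) p.2 v w, h]
  rfl

theorem bijective_lift (t : ℝ) : Function.Bijective (g.lift t) := by
  constructor
  · intro u v huv
    have h : proj u = proj v := (g.map t).injective (by rw [← hg.isLift, ← hg.isLift, huv])
    obtain ⟨m, rfl⟩ := proj_eq_proj_iff.1 h
    rw [hg.lift_add] at huv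
    rw [show latticePt m = 0 by simpa using huv, add_zero]
  · intro w
    obtain ⟨m, hm⟩ : ∃ m, w = g.lift t (rep ((g.map t).symm (proj w))) + latticePt m :=
      proj_eq_proj_iff.1 (by rw [hg.isLift, proj_rep, Equiv.apply_symm_apply])
    exact ⟨rep ((g.map t).symm (proj w)) + latticePt m, by rw [hg.lift_add, ← hm]⟩

/-- Inverse function theorem for the bijection $(t,u)\mapsto(t,F_t(u))$, whose derivative is
injective because the area form is nondegenerate. It makes $X_t=\partial_tF_t\circ F_t^{-1}$ jointly
smooth in $(t,u)$. -/
theorem exists_contDiff_leftInverse : ∃ G : ℝ × Plane → Plane, ContDiff ℝ ∞ G ∧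
    ∀ t u, G (t, g.lift t u) = u := by
  set F : ℝ × Plane → Plane := fun p => g.lift p.1 p.2 with hF
  set Φ : ℝ × Plane → ℝ × Plane := fun p => (p.1, F p) with hΦ
  have hΦs : ContDiff ℝ ∞ Φ := contDiff_fst.prodMk hg.contDiff
  set L : ℝ × Plane → (ℝ × Plane →L[ℝ] ℝ × Plane) := fun p =>
    (ContinuousLinearMap.fst ℝ ℝ Plane).prod (fderiv ℝ F p) with hL
  have hΦd : ∀ p, HasFDerivAt Φ (L p) p := fun p =>
    hasFDerivAt_fst.prodMk (hg.hasFDerivAt p)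
  have hinj : ∀ p, Function.Injective (L p : ℝ × Plane →ₗ[ℝ] ℝ × Plane) := fun p => by
    rw [← LinearMap.ker_eq_bot, LinearMap.ker_eq_bot']
    rintro ⟨τ, v⟩ h
    obtain ⟨rfl, h2⟩ : τ = 0 ∧ fderiv ℝ F p (τ, v) = 0 := by simpa [hL] using h
    have : v = 0 := areaForm_eq_zero_iff.1 fun w => by
      rw [← hg.areaForm_fderiv p v w, h2]
      simp [areaForm]
    rw [this]
    rfl
  let L' : ℝ × Plane → ((ℝ × Plane) ≃L[ℝ] (ℝ × Plane)) := fun p =>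
    (LinearEquiv.ofInjectiveEndo _ (hinj p)).toContinuousLinearEquiv
  have hL' : ∀ p, (L' p : ℝ × Plane →L[ℝ] ℝ × Plane) = L p := fun p =>
    ContinuousLinearMap.ext fun _ => rfl
  have hbij : Function.Bijective Φ := by
    constructor
    · rintro ⟨t, u⟩ ⟨s, v⟩ h
      obtain ⟨rfl, h2⟩ := Prod.ext_iff.1 h
      exact Prod.ext rfl ((hg.bijective_lift _).1 h2)
    · rintro ⟨t, w⟩
      obtain ⟨u, hu⟩ := (hg.bijective_lift t).2 w
      exact ⟨(t, u), Prod.ext rfl hu⟩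
  have hopen : IsOpenMap Φ := isOpenMap_of_hasStrictFDerivAt_equiv (f' := L') fun p =>
    hΦs.contDiffAt.hasStrictFDerivAt' (by rw [hL']; exact hΦd p) (by simp)
  let e : ℝ × Plane ≃ₜ ℝ × Plane :=
    (Equiv.ofBijective Φ hbij).toHomeomorphOfContinuousOpen hΦs.continuous hopen
  have he : ∀ p, e p = Φ p := fun p => rfl
  have hes : ContDiff ℝ ∞ e.symm :=
    e.contDiff_symm (f₀' := L') (fun p => by rw [hL']; exact hΦd p) hΦs
  refine ⟨fun q => (e.symm q).2, contDiff_snd.comp hes, fun t u => ?_⟩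
  have h := e.symm_apply_apply (t, u)
  rw [he] at h
  exact congrArg Prod.snd h

/-- Closedness of $\omega(X_t,\cdot)$: differentiate $F_t^*\omega=\omega$ in time and exchange time
and space derivatives. Points $F_t(u)$ and vectors $DF_t\,v$ suffice, as both exhaust the plane. -/
theorem areaForm_fderiv_velocity_symm {X : ℝ × Plane → Plane} (hX : ContDiff ℝ ∞ X)
    (hXF : ∀ t u, X (t, g.lift t u) =
      fderiv ℝ (fun p : ℝ × Plane => g.lift p.1 p.2) (t, u) (1, 0)) (t : ℝ) (w a b : Plane) :
    areaForm (fderiv ℝ (fun u => X (t, u)) w a) b =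
      areaForm (fderiv ℝ (fun u => X (t, u)) w b) a := by
  obtain ⟨u, rfl⟩ := (hg.bijective_lift t).2 w
  have hsurj : ∀ a, ∃ v, fderiv ℝ (fun p : ℝ × Plane => g.lift p.1 p.2) (t, u) (0, v) = a :=
    (equivOfAreaForm ((fderiv ℝ (fun p : ℝ × Plane => g.lift p.1 p.2) (t, u)).comp
      (ContinuousLinearMap.inr ℝ ℝ Plane)) (hg.areaForm_fderiv (t, u))).surjective
  obtain ⟨v, rfl⟩ := hsurj a
  obtain ⟨w, rfl⟩ := hsurj b
  have h := areaForm_fderiv_fderiv hg.contDiff hg.areaForm_fderiv (t, u) v w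
  have hsymm := second_derivative_symmetric (fun p => hg.hasFDerivAt p)
    ((hg.contDiff.fderiv_right (m := ∞) (by simp)).differentiable (by simp) (t, u)).hasFDerivAt
  rw [hsymm (1, 0) (0, v), hsymm (1, 0) (0, w),
    ← fderiv_velocity_apply hg.contDiff hX hXF, ← fderiv_velocity_apply hg.contDiff hX hXF] at h
  simp only [areaForm] at h ⊢
  linarith

/-- An isotopy is Hamiltonian when its velocity has mean zero at every time. -/
theorem isHamiltonian (hmean : ∀ t ∈ Icc (0 : ℝ) 1, ∫ u in cell, g.timeDeriv t u = 0) :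
    g.IsHamiltonian := by
  obtain ⟨G, hG, hGF⟩ := hg.exists_contDiff_leftInverse
  set X : ℝ × Plane → Plane := fun p =>
    fderiv ℝ (fun p : ℝ × Plane => g.lift p.1 p.2) (p.1, G p) (1, 0) with hX
  have hXs : ContDiff ℝ ∞ X :=
    ((hg.contDiff.fderiv_right (m := ∞) (by simp)).comp (contDiff_fst.prodMk hG)).clm_apply
      contDiff_const
  have hXt : ∀ t, ContDiff ℝ ∞ fun u => X (t, u) := fun t =>
    hXs.comp (by fun_prop : ContDiff ℝ ∞ fun u : Plane => (t, u))
  have hXF : ∀ t u, X (t, g.lift t u) =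
      fderiv ℝ (fun p : ℝ × Plane => g.lift p.1 p.2) (t, u) (1, 0) := fun t u => by
    simp only [hX, hGF]
  have hvel : ∀ t ∈ Icc (0 : ℝ) 1, ∀ u, X (t, u) = g.velocity t (proj u) := fun t ht u => by
    obtain ⟨u, rfl⟩ := (hg.bijective_lift t).2 u
    rw [hXF, g.velocity_proj_lift ht, hg.timeDeriv_eq ht]
  have hXper : ∀ t ∈ Icc (0 : ℝ) 1, ∀ u m, X (t, u + latticePt m) = X (t, u) :=
    fun t ht u m => by rw [hvel t ht, hvel t ht, proj_add_latticePt]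
  have hXmean : ∀ t ∈ Icc (0 : ℝ) 1, ∫ u in cell, X (t, u) = 0 := fun t ht => by
    rw [← setIntegral_cell_comp_isLift (g.map_mem t ht) (g.contDiff_lift ht).continuous
      (g.isLift t ht) (hXt t).continuous (hXper t ht), ← hmean t ht]
    simp only [hXF, hg.timeDeriv_eq ht]
  set K : ℝ × Plane → ℝ := fun p => primitive (fun u => X (p.1, u)) p.2 with hK
  have hKs : ContDiff ℝ ∞ K := contDiff_primitive hXs
  have hKt : ∀ t, ContDiff ℝ ∞ fun u => K (t, u) := fun t =>
    hKs.comp (by fun_prop : ContDiff ℝ ∞ fun u : Plane => (t, u))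
  have hKd : ∀ t u, HasFDerivAt (fun u => K (t, u)) (areaFormL (X (t, u))) u := fun t u =>
    hasFDerivAt_primitive (hXt t) (hg.areaForm_fderiv_velocity_symm hXs hXF t) u
  -- As `X` is periodic, the increment of `K` along a lattice vector is constant; it equals its
  -- average, the area form of the mean of `X` with that vector, hence zero.
  have hKper : ∀ t ∈ Icc (0 : ℝ) 1, ∀ u m, K (t, u + latticePt m) = K (t, u) :=
    fun t ht u m => by
    have hd : ∀ u, HasFDerivAt (fun u => K (t, u + latticePt m) - K (t, u))
        (0 : Plane →L[ℝ] ℝ) u := fun u => by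
      have h := (HasFDerivAt.comp (g := fun u => K (t, u)) u (hKd t (u + latticePt m))
        ((hasFDerivAt_id u).add_const (latticePt m))).sub (hKd t u)
      rw [ContinuousLinearMap.comp_id] at h
      rw [hXper t ht, sub_self] at h
      exact h
    have hconst : ∀ v, K (t, v + latticePt m) - K (t, v) = K (t, u + latticePt m) - K (t, u) :=
      fun v => is_const_of_fderiv_eq_zero (𝕜 := ℝ)
        (fun u => (hd u).differentiableAt) (fun u => (hd u).fderiv) v u
    have hint := setIntegral_cell_fderiv_apply (hKt t) (latticePt m) fun u n => by
      rw [(hKd t _).fderiv, (hKd t _).fderiv, hXper t ht]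
    simp only [hconst, (hKd t _).fderiv, ← ContinuousLinearMap.flip_apply areaFormL] at hint
    rw [ContinuousLinearMap.integral_comp_comm _ (integrableOn_cell (hXt t).continuous),
      hXmean t ht] at hint
    simpa [sub_eq_zero] using hint
  have hKrep : ∀ t ∈ Icc (0 : ℝ) 1, ∀ u, K (t, rep (proj u)) = K (t, u) := fun t ht u => by
    obtain ⟨m, hm⟩ := exists_eq_rep_add u
    conv_rhs => rw [hm, hKper t ht]
  refine ⟨fun t x => K (t, rep x), hKs.contDiffOn.congr fun p hp => hKrep p.1 hp.1 p.2,
    fun t ht u v => ?_⟩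
  have : (fun w => K (t, rep (proj w))) = fun w => K (t, w) := funext (hKrep t ht)
  rw [this, (hKd t u).fderiv, areaFormL_apply, hvel t ht]

omit hg

end IsComplete

/-- The mean velocity paired with a lattice vector is the average increment of $H_t$ along it, zero
by periodicity. Two lattice vectors detect both coordinates. -/
theorem IsHamiltonian.setIntegral_timeDeriv {g : Isotopy} (hg : g.IsHamiltonian) {t : ℝ}
    (ht : t ∈ Icc (0 : ℝ) 1) : ∫ u in cell, g.timeDeriv t u = 0 := by
  obtain ⟨H, hH, hv⟩ := hg
  set K : Plane → ℝ := fun w => H t (proj w) with hK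
  have hKs : ContDiff ℝ ∞ K := by
    rw [← contDiffOn_univ]
    exact hH.comp (f := fun u => (t, u)) (by fun_prop) fun u _ => ⟨ht, mem_univ u⟩
  have hKv : ∀ u v, fderiv ℝ K u v = areaForm (g.velocity t (proj u)) v := fun u v =>
    (hv t ht u v).symm
  -- The coordinates of the velocity are values of $dH_t$, so its continuity comes from that of
  -- $dH_t$.
  have hvc : Continuous fun u => g.velocity t (proj u) := by
    have h : ∀ v, Continuous fun u => areaForm (g.velocity t (proj u)) v := fun v => by
      simp only [hv t ht]
      exact (hKs.continuous_fderiv (by simp)).clm_apply continuous_const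
    have h0 := h (latticePt ![0, 1])
    have h1 := h (latticePt ![-1, 0])
    simp only [areaForm_latticePt_snd, areaForm_latticePt_fst] at h0 h1
    rw [(PiLp.homeomorph 2 _).isInducing.continuous_iff]
    refine continuous_pi fun i => ?_
    fin_cases i
    · exact h0
    · exact h1
  have hmean : ∫ u in cell, g.velocity t (proj u) = 0 := by
    have h : ∀ m, areaForm (∫ u in cell, g.velocity t (proj u)) (latticePt m) = 0 := fun m => by
      have hint := setIntegral_cell_fderiv_apply hKs (latticePt m) fun u n => by
        rw [hKv, hKv, proj_add_latticePt]
      simp only [hKv, ← areaFormL_apply, ← ContinuousLinearMap.flip_apply areaFormL] at hint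
      rw [ContinuousLinearMap.integral_comp_comm _ (integrableOn_cell hvc)] at hint
      rw [← areaFormL_apply, ← ContinuousLinearMap.flip_apply areaFormL, ← hint]
      simp [hK]
    have h0 := h ![0, 1]
    have h1 := h ![-1, 0]
    rw [areaForm_latticePt_snd] at h0
    rw [areaForm_latticePt_fst] at h1
    ext i
    fin_cases i
    · exact h0
    · exact h1
  rw [← hmean, ← setIntegral_cell_comp_isLift (g.map_mem t ht) (g.contDiff_lift ht).continuous
      (g.isLift t ht) hvc fun u m => by rw [proj_add_latticePt]]
  simp only [g.velocity_proj_lift ht]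

/-! ### The flux -/

/-- The average of the lift of an isotopy over the unit cell. -/
def meanLift (g : Isotopy) (t : ℝ) : Plane := ∫ u in cell, g.lift t u

theorem flux_eq (g : Isotopy) : g.flux = g.meanLift 1 - g.meanLift 0 :=
  integral_sub (integrableOn_cell (g.contDiff_lift (by simp)).continuous)
    (integrableOn_cell (g.contDiff_lift (by simp)).continuous)

theorem meanLift_translate (g : Isotopy) {w : ℝ → Plane} (hw : ContDiff ℝ ∞ w) (h0 : w 0 = 0)
    {t : ℝ} (ht : t ∈ Icc (0 : ℝ) 1) :
    (g.translate w hw h0).meanLift t = g.meanLift t + w t := by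
  simp only [meanLift, translate]
  rw [integral_add (integrableOn_cell (g.contDiff_lift ht).continuous) (integrable_const _)]
  simp

theorem flux_translate (g : Isotopy) {w : ℝ → Plane} (hw : ContDiff ℝ ∞ w) (h0 : w 0 = 0) :
    (g.translate w hw h0).flux = g.flux + w 1 := by
  rw [flux_eq, flux_eq, g.meanLift_translate hw h0 (by simp),
    g.meanLift_translate hw h0 (by simp), h0]
  abel

/-- Both lifts cover the same map at time 1 and the identity at time 0, so the two displacement
fields differ by a constant lattice vector. -/
theorem flux_sub_flux_mem_range {g h : Isotopy} (hgh : g.map 1 = h.map 1) :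
    ∃ m, g.flux - h.flux = latticePt m := by
  have m1 : (1 : ℝ) ∈ Icc (0 : ℝ) 1 := by simp
  obtain ⟨a, ha⟩ := g.exists_lift_zero_eq
  obtain ⟨b, hb⟩ := h.exists_lift_zero_eq
  have hg := g.isLift 1 m1
  rw [hgh] at hg
  obtain ⟨c, hc⟩ := hg.exists_eq_add (h.isLift 1 m1) (g.contDiff_lift m1).continuous
    (h.contDiff_lift m1).continuous
  have hlift : ∀ u, g.lift 1 u - g.lift 0 u =
      (h.lift 1 u - h.lift 0 u) + latticePt (c + b - a) := fun u => by
    rw [ha, hb, hc, map_sub, map_add]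
    abel
  refine ⟨c + b - a, ?_⟩
  simp only [flux, hlift]
  rw [integral_add (f := fun u => h.lift 1 u - h.lift 0 u)
    (integrableOn_cell ((h.contDiff_lift m1).continuous.sub
      (h.contDiff_lift (by simp)).continuous)) (integrable_const _)]
  simp

theorem IsComplete.contDiff_meanLift {g : Isotopy} (hg : g.IsComplete) :
    ContDiff ℝ ∞ g.meanLift :=
  contDiff_integral_of_contDiff isCompact_closedBall_plane ae_mem_closedBall hg.contDiff

theorem IsComplete.deriv_meanLift {g : Isotopy} (hg : g.IsComplete) {t : ℝ}
    (ht : t ∈ Icc (0 : ℝ) 1) : deriv g.meanLift t = ∫ u in cell, g.timeDeriv t u := by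
  have h := (hasFDerivAt_integral_of_contDiff isCompact_closedBall_plane ae_mem_closedBall
    hg.contDiff t).hasDerivAt.deriv
  have hcont : Continuous fun u : Plane =>
      (fderiv ℝ (fun p : ℝ × Plane => g.lift p.1 p.2) (t, u)).comp
        (ContinuousLinearMap.inl ℝ ℝ Plane) :=
    ((hg.contDiff.continuous_fderiv (by simp)).comp (by fun_prop)).clm_comp continuous_const
  rw [ContinuousLinearMap.integral_apply (integrable_of_continuous_of_isCompact
    isCompact_closedBall_plane ae_mem_closedBall hcont)] at h
  refine h.trans ?_
  simp only [hg.timeDeriv_eq ht]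
  rfl

/-! ### Smoothing the ends of an isotopy and making it Hamiltonian. -/

theorem smoothTransition_mem_Icc (t : ℝ) : Real.smoothTransition t ∈ Icc (0 : ℝ) 1 :=
  ⟨Real.smoothTransition.nonneg t, Real.smoothTransition.le_one t⟩

/-- The isotopy reparametrised so that it is constant near both ends. -/
def smoothed (g : Isotopy) : Isotopy :=
  g.reparam Real.smoothTransition Real.smoothTransition.contDiff
    (fun t _ => smoothTransition_mem_Icc t) Real.smoothTransition.zero

theorem isComplete_smoothed (g : Isotopy) : g.smoothed.IsComplete :=
  g.isComplete_reparam _ smoothTransition_mem_Icc _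

theorem map_one_smoothed (g : Isotopy) : g.smoothed.map 1 = g.map 1 := by
  simp [smoothed, reparam, Real.smoothTransition.one]

theorem flux_smoothed (g : Isotopy) : g.smoothed.flux = g.flux := by
  simp [flux, smoothed, reparam, Real.smoothTransition.one, Real.smoothTransition.zero]

theorem length_smoothed_le (g : Isotopy) : g.smoothed.length ≤ g.length :=
  g.length_reparam_le _ _ _ Real.smoothTransition.monotone

theorem IsHamiltonian.flux_eq_zero {g : Isotopy} (hg : g.IsHamiltonian) : g.flux = 0 := by
  have hs : g.smoothed.IsHamiltonian := hg.reparam _ _ _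
  have hc := g.isComplete_smoothed
  rw [← flux_smoothed, flux_eq, sub_eq_zero]
  refine constant_of_has_deriv_right_zero (b := 1)
    hc.contDiff_meanLift.continuous.continuousOn (fun t ht => ?_) 1 (by simp)
  have hd := (hc.contDiff_meanLift.differentiable (by simp) t).hasDerivAt
  rw [hc.deriv_meanLift (Ico_subset_Icc_self ht),
    hs.setIntegral_timeDeriv (Ico_subset_Icc_self ht)] at hd
  exact hd.hasDerivWithinAt

/-- An isotopy with integral flux can be replaced by a Hamiltonian isotopy with the same endpoint
and at most twice the length. -/
theorem exists_isHamiltonian_of_flux {g : Isotopy} {m : Fin 2 → ℤ} (hm : g.flux = latticePt m) :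
    ∃ k : Isotopy, k.IsHamiltonian ∧ k.map 1 = g.map 1 ∧ k.length ≤ 2 * g.length := by
  set s := g.smoothed with hs
  have hc : s.IsComplete := g.isComplete_smoothed
  -- Minus the mean displacement up to time `t`; its derivative cancels the mean velocity.
  have hw : ContDiff ℝ ∞ fun t => -(s.meanLift t - s.meanLift 0) :=
    (hc.contDiff_meanLift.sub contDiff_const).neg
  have hw0 : -(s.meanLift 0 - s.meanLift 0) = 0 := by simp
  have hwd : ∀ t ∈ Icc (0 : ℝ) 1, deriv (fun t => -(s.meanLift t - s.meanLift 0)) t =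
      -∫ u in cell, s.timeDeriv t u := fun t ht => by
    rw [deriv.fun_neg, deriv_sub_const, hc.deriv_meanLift ht]
  refine ⟨s.translate _ hw hw0, (hc.translate hw hw0).isHamiltonian fun t ht => ?_, ?_, ?_⟩
  · simp only [s.timeDeriv_translate hw hw0 ht, hwd t ht]
    rw [integral_add (integrableOn_cell (s.continuous_timeDeriv ht)) (integrable_const _)]
    simp
  -- The final translation is by minus the flux, a lattice vector, so the endpoint does not move.
  · have : proj (-(s.meanLift 1 - s.meanLift 0)) = 0 := by
      rw [← flux_eq, hs, flux_smoothed, hm, proj_neg, proj_latticePt, neg_zero]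
    rw [← map_one_smoothed g]
    ext1 x
    change s.map 1 x + proj (-(s.meanLift 1 - s.meanLift 0)) = _
    rw [this, add_zero]
  · refine le_trans ?_ (mul_le_mul_right g.length_smoothed_le 2)
    rw [length_eq, length_eq, ← lintegral_const_mul' _ _ (by simp)]
    refine setLIntegral_mono' measurableSet_Icc fun t ht => ?_
    -- The added translation velocity costs at most the original $L^1$-norm, as the cell has area
    -- one; hence the factor 2.
    have hint : ‖-∫ u in cell, s.timeDeriv t u‖ₑ ≤ ∫⁻ u in cell, ‖s.timeDeriv t u‖ₑ := by
      rw [enorm_neg]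
      exact enorm_integral_le_lintegral_enorm _
    calc ∫⁻ u in cell, ‖(s.translate _ hw hw0).timeDeriv t u‖ₑ
        ≤ ∫⁻ u in cell, (‖s.timeDeriv t u‖ₑ + ‖-∫ u in cell, s.timeDeriv t u‖ₑ) := by
          refine lintegral_mono fun u => ?_
          rw [s.timeDeriv_translate hw hw0 ht, hwd t ht]
          exact enorm_add_le _ _
      _ = (∫⁻ u in cell, ‖s.timeDeriv t u‖ₑ) + ‖-∫ u in cell, s.timeDeriv t u‖ₑ := by
          rw [lintegral_add_right _ measurable_const, lintegral_const, measure_univ, mul_one]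
      _ ≤ 2 * ∫⁻ u in cell, ‖s.timeDeriv t u‖ₑ := by
          rw [two_mul]
          exact add_le_add_right hint _

theorem exists_flux_eq_latticePt {g : Isotopy} (hg : g.map 1 ∈ ham) :
    ∃ m, g.flux = latticePt m := by
  obtain ⟨h, hh, hgh⟩ := hg
  obtain ⟨m, hm⟩ := flux_sub_flux_mem_range hgh.symm
  exact ⟨m, by rw [← hm, hh.flux_eq_zero, sub_zero]⟩

/-- The constant isotopy. -/
def refl : Isotopy where
  map _ := 1
  lift _ u := u
  map_mem _ _ := one_mem_areaDiff
  map_zero := rfl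
  smooth := contDiff_snd.contDiffOn
  isLift _ _ := isLift_id

theorem length_translation (v : Plane) :
    (refl.translate (fun t => t • v) (by fun_prop) (zero_smul ℝ v)).length = ‖v‖ₑ := by
  rw [length_eq]
  have h : ∀ t ∈ Icc (0 : ℝ) 1, ∀ u,
      (refl.translate (fun t => t • v) (by fun_prop) (zero_smul ℝ v)).timeDeriv t u = v :=
    fun t ht u => by
      rw [refl.timeDeriv_translate _ _ ht]
      have h1 : refl.timeDeriv t u = 0 := by simp [timeDeriv, refl]
      have h2 : HasDerivAt (fun t : ℝ => t • v) v t := by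
        simpa using (hasDerivAt_id t).smul_const v
      rw [h1, h2.deriv, zero_add]
  rw [setLIntegral_congr_fun measurableSet_Icc fun t ht => lintegral_congr fun u => by
    rw [h t ht u]]
  simp

end Isotopy

/-! ### The `L¹`-metrics -/

theorem l1Dist_le_length {S : Set (Equiv.Perm Torus)} {φ ψ : S} {g : Isotopy}
    (hg : ∀ t ∈ Icc (0 : ℝ) 1, g.map t ∈ S)
    (h1 : g.map 1 = (ψ : Equiv.Perm Torus) * (φ : Equiv.Perm Torus)⁻¹) :
    l1Dist S φ ψ ≤ g.length :=
  iInf_le_of_le g (iInf_le_of_le hg (iInf_le _ h1))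

theorem l1Dist_diff0_lt_top (φ ψ : diff0) : l1Dist diff0 φ ψ < ⊤ := by
  obtain ⟨g, hg⟩ := φ.2
  obtain ⟨h, hh⟩ := ψ.2
  obtain ⟨k, hk, -⟩ := g.exists_mul_inv h
  rw [hg, hh] at hk
  exact (l1Dist_le_length (fun t ht => k.map_mem_diff0 ht) hk).trans_lt k.length_lt_top

theorem l1Dist_diff0_hamIncl_le (h k : ham) :
    l1Dist diff0 (hamIncl h) (hamIncl k) ≤ l1Dist ham h k :=
  le_iInf fun g => le_iInf fun _ => le_iInf fun h1 =>
    l1Dist_le_length (fun _ ht => g.map_mem_diff0 ht) h1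

/-- Fluxes subtract under `exists_mul_inv`, and an isotopy of flux zero can be replaced by a
Hamiltonian one. -/
theorem mul_inv_mem_ham {φ ψ : Equiv.Perm Torus} (hφ : φ ∈ ham) (hψ : ψ ∈ ham) :
    ψ * φ⁻¹ ∈ ham := by
  obtain ⟨g, hgH, rfl⟩ := hφ
  obtain ⟨h, hhH, rfl⟩ := hψ
  obtain ⟨k, hk, hf⟩ := g.exists_mul_inv h
  rw [hgH.flux_eq_zero, hhH.flux_eq_zero, sub_zero] at hf
  obtain ⟨k', hk'H, hk', -⟩ := Isotopy.exists_isHamiltonian_of_flux (m := 0)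
    (hf.trans (map_zero latticePt).symm)
  exact ⟨k', hk'H, hk'.trans hk⟩

theorem l1Dist_ham_lt_top (φ ψ : ham) : l1Dist ham φ ψ < ⊤ := by
  obtain ⟨k, hkH, hk⟩ := mul_inv_mem_ham φ.2 ψ.2
  exact (l1Dist_le_length (fun t ht => hkH.map_mem_ham ht) hk).trans_lt k.length_lt_top

theorem l1Dist_ham_le (h k : ham) :
    l1Dist ham h k ≤ 2 * l1Dist diff0 (hamIncl h) (hamIncl k) := by
  simp only [l1Dist, ENNReal.mul_iInf_of_ne two_ne_zero ENNReal.ofNat_ne_top]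
  refine le_iInf fun g => le_iInf fun _ => le_iInf fun h1 => ?_
  have hmem : g.map 1 ∈ ham := h1 ▸ mul_inv_mem_ham h.2 k.2
  obtain ⟨m, hm⟩ := Isotopy.exists_flux_eq_latticePt hmem
  obtain ⟨g', hg'H, hg', hlen⟩ := Isotopy.exists_isHamiltonian_of_flux hm
  exact (l1Dist_le_length (fun t ht => hg'H.map_mem_ham ht) (hg'.trans h1)).trans hlen

theorem isCoarselyDense_hamIncl : IsCoarselyDense (l1Dist diff0) hamIncl := by
  refine ⟨2, fun φ => ?_⟩
  obtain ⟨g, hg⟩ := φ.2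
  set v := g.flux
  have hw : ContDiff ℝ ∞ fun t : ℝ => -(t • v) := by fun_prop
  -- The translations cancel the flux of `g`, so `k.map 1` is Hamiltonian and differs from `φ` by
  -- the translation by `proj v`.
  set k := g.translate (fun t => -(t • v)) hw (by simp) with hk
  have hflux : k.flux = latticePt 0 := by
    rw [hk, g.flux_translate]
    simp [v]
  obtain ⟨h, hhH, hh, -⟩ := Isotopy.exists_isHamiltonian_of_flux hflux
  have hmem : k.map 1 ∈ ham := hh ▸ ⟨h, hhH, rfl⟩
  refine ⟨⟨k.map 1, hmem⟩, ?_⟩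
  -- Translating by `rep (proj v)` instead of `v` has the same endpoint, and its length is at most 2
  -- whatever the flux.
  refine (l1Dist_le_length (g := Isotopy.refl.translate (fun t => t • rep (proj v)) (by fun_prop)
    (zero_smul ℝ _)) (fun t ht => Isotopy.map_mem_diff0 _ ht) ?_).trans ?_
  · change _ = (φ : Equiv.Perm Torus) * (k.map 1)⁻¹
    rw [eq_mul_inv_iff_mul_eq, ← hg]
    ext1 x
    simp [hk, Isotopy.translate, Isotopy.refl, proj_rep, proj_neg]
  · rw [Isotopy.length_translation, ← ofReal_norm]
    have := cell_subset_closedBall (rep_mem_cell (proj v))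
    rw [mem_closedBall_zero_iff] at this
    simpa using ENNReal.ofReal_le_ofReal this

end TorusL1

end

theorem propositionA1 :
    (∀ φ ψ : TorusL1.diff0, TorusL1.l1Dist TorusL1.diff0 φ ψ < ⊤) ∧
    (∀ h k : TorusL1.ham, TorusL1.l1Dist TorusL1.ham h k < ⊤) ∧
    TorusL1.IsQuasiIsometry (TorusL1.l1Dist TorusL1.ham) (TorusL1.l1Dist TorusL1.diff0)
      TorusL1.hamIncl ∧
    TorusL1.IsCoarselyDense (TorusL1.l1Dist TorusL1.diff0) TorusL1.hamIncl ∧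
    ∃ c : ℝ≥0, 0 < c ∧ c < 1 ∧ ∀ h k : TorusL1.ham,
      c * TorusL1.l1Dist TorusL1.ham h k
          ≤ TorusL1.l1Dist TorusL1.diff0 (TorusL1.hamIncl h) (TorusL1.hamIncl k) ∧
        TorusL1.l1Dist TorusL1.diff0 (TorusL1.hamIncl h) (TorusL1.hamIncl k)
          ≤ TorusL1.l1Dist TorusL1.ham h k := by
  refine ⟨TorusL1.l1Dist_diff0_lt_top, TorusL1.l1Dist_ham_lt_top,
    ⟨⟨2, 0, fun h k => ⟨?_, ?_⟩⟩, TorusL1.isCoarselyDense_hamIncl⟩,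
    TorusL1.isCoarselyDense_hamIncl, 2⁻¹, by norm_num, by
      rw [← NNReal.coe_lt_coe]; norm_num, fun h k => ⟨?_, TorusL1.l1Dist_diff0_hamIncl_le h k⟩⟩
  · calc _ ≤ TorusL1.l1Dist TorusL1.ham h k := TorusL1.l1Dist_diff0_hamIncl_le h k
      _ ≤ 2 * TorusL1.l1Dist TorusL1.ham h k := le_mul_of_one_le_left' one_le_two
      _ = _ := by simp
  · simpa using TorusL1.l1Dist_ham_le h k
  · rw [ENNReal.coe_inv two_ne_zero, mul_comm, ← div_eq_mul_inv]
    exact ENNReal.div_le_of_le_mul' (TorusL1.l1Dist_ham_le h k)
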